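/- For an integer $m\ge 3$ let $\mathcal A_m$ be the mid-hyperplane arrangement in $\mathbb R^m$: it consists of the hyperplanes $x_i=x_j$ $(1\le i<j\le m)$ and the hyperplanes $x_p+x_q=x_r+x_s$ for distinct $p,q,r,s\in\{1,\dots,m\}$ with $p<q$ and $p<r<s$. Let $M(\mathcal A_m)\subset\mathbb R^m$ be the complement of the union of these hyperplanes and $\mathbf{Ch}(\mathcal A_m)$ the set of its connected components (chambers). Let $L(\mathcal A_m)$ be the set of intersections of subfamilies of $\mathcal A_m$ (including $\mathbb R^m$, the empty intersection), ordered by reverse inclusion, let $\mu:L(\mathcal A_m)\to\mathbb Z$ be its Möbius function, defined by $\mu(\mathbb R^m)=1$ and $\sum_{Y\le X}\mu(Y)=0$ for $X>\mathbb R^m$, and let $\chi(\mathcal A_m,t)=\sum_{X\in L(\mathcal A_m)}\mu(X)\,t^{\dim X}$ be the characteristic polynomial. For $\mathbf x=(x_1,\dots,x_m)\in M(\mathcal A_m)$, the ranking pattern of $\mathbf x$ is the set of all permutations $(i_1\dots i_m)$ of $\{1,\dots,m\}$ such that $|y-x_{i_1}|<|y-x_{i_2}|<\dots<|y-x_{i_m}|$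 for some real $y$ different from all midpoints $(x_i+x_j)/2$, $i<j$. Let $r(m)$ be the number of distinct ranking patterns of the points $\mathbf x\in M(\mathcal A_m)$ with $x_1<x_2<\dots<x_m$. Then \[ \begin{array}{c|l|r|r} m & \chi(\mathcal A_m,t) & |\mathbf{Ch}(\mathcal A_m)| & r(m)\\ \hline 3 & t(t-1)(t-2) & 6 & 1\\ 4 & t(t-1)(t-3)(t-5) & 48 & 2\\ 5 & t(t-1)(t-7)(t-8)(t-9) & 1440 & 12\\ 6 & t(t-1)(t-13)(t-14)(t-15)(t-17) & 120960 & 168\\ 7 & t(t-1)(t-23)(t-24)(t-25)(t-26)(t-27) & 23587200 & 4680 \end{array} \] -/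

import Mathlib

namespace RankingPattern

open scoped Polynomial

section Arrangement

variable {K V : Type*} [Field K] [AddCommGroup V] [Module K V]

/-- The intersection poset `L(𝒜)` of a finite set `𝒜` of linear hyperplanes: all intersections
of subfamilies of `𝒜` (the empty intersection being `V`; all of them are nonempty since they
contain `0`), ordered by REVERSE inclusion, whence the order dual. -/
abbrev IntersectionPoset (𝒜 : Finset (Submodule K V)) : Type _ :=
  {X : Submodule K V // ∃ ℬ : Finset (Submodule K V), ℬ ⊆ 𝒜 ∧ X = ℬ.inf id}ᵒᵈ

/-- The edge of `𝒜` as a linear subspace of `V`. -/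
def IntersectionPoset.space {𝒜 : Finset (Submodule K V)} (X : IntersectionPoset 𝒜) :
    Submodule K V :=
  (OrderDual.ofDual X).1

/-- The minimal element `V` of `L(𝒜)`. -/
def IntersectionPoset.whole (𝒜 : Finset (Submodule K V)) : IntersectionPoset 𝒜 :=
  OrderDual.toDual ⟨⊤, ∅, Finset.empty_subset _, Finset.inf_empty.symm⟩

theorem IntersectionPoset.le_iff {𝒜 : Finset (Submodule K V)} (X Y : IntersectionPoset 𝒜) :
    X ≤ Y ↔ Y.space ≤ X.space :=
  Iff.rfl

theorem IntersectionPoset.finite (𝒜 : Finset (Submodule K V)) :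
    Finite (IntersectionPoset 𝒜) := by
  refine Set.Finite.subset (Set.Finite.image (fun ℬ : Finset (Submodule K V) => ℬ.inf id)
    (𝒜.powerset.finite_toSet)) ?_
  rintro X ⟨ℬ, h, rfl⟩
  exact ⟨ℬ, by simpa using h, rfl⟩

noncomputable instance (𝒜 : Finset (Submodule K V)) : Fintype (IntersectionPoset 𝒜) :=
  @Fintype.ofFinite _ (IntersectionPoset.finite 𝒜)

open Classical in
noncomputable instance (𝒜 : Finset (Submodule K V)) :
    LocallyFiniteOrder (IntersectionPoset 𝒜) :=
  Fintype.toLocallyFiniteOrder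

open Classical in
/-- The Möbius function `μ(X) = μ(V, X)` of `L(𝒜)`. -/
noncomputable def moebius (𝒜 : Finset (Submodule K V)) (X : IntersectionPoset 𝒜) : ℤ :=
  IncidenceAlgebra.mu ℤ (IntersectionPoset.whole 𝒜) X

/-- The Möbius function has the value `1` at `V`. -/
theorem moebius_whole (𝒜 : Finset (Submodule K V)) :
    moebius 𝒜 (IntersectionPoset.whole 𝒜) = 1 := by
  classical
  simp [moebius]

open Classical in
/-- The defining recursion of the Möbius function: for `X > V`, `∑_{Y ≤ X} μ(Y) = 0`. -/
theorem sum_moebius (𝒜 : Finset (Submodule K V)) (X : IntersectionPoset 𝒜)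
    (hX : X ≠ IntersectionPoset.whole 𝒜) :
    ∑ Y : IntersectionPoset 𝒜 with Y ≤ X, moebius 𝒜 Y = 0 := by
  have h := IncidenceAlgebra.sum_Icc_mu_right (𝕜 := ℤ) (IntersectionPoset.whole 𝒜) X
  rw [if_neg (Ne.symm hX)] at h
  rw [← h]
  refine Finset.sum_congr ?_ fun _ _ => rfl
  ext Y
  have hY : IntersectionPoset.whole 𝒜 ≤ Y :=
    (IntersectionPoset.le_iff _ _).2 (show Y.space ≤ (⊤ : Submodule K V) from le_top)
  simp [Finset.mem_Icc, hY]

/-- The characteristic polynomial `χ(𝒜, t) = ∑_{X ∈ L(𝒜)} μ(X) t^{dim X}`. -/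
noncomputable def charPoly (𝒜 : Finset (Submodule K V)) : ℤ[X] :=
  ∑ Y : IntersectionPoset 𝒜,
    Polynomial.C (moebius 𝒜 Y) * Polynomial.X ^ Module.finrank K Y.space

/-- The complement `M(𝒜)` of the union of the hyperplanes in `𝒜`. -/
def complement (𝒜 : Finset (Submodule K V)) : Set V :=
  {x | ∀ H ∈ 𝒜, x ∉ H}

/-- The set of chambers of `𝒜`: the connected components of `M(𝒜)`. -/
def chambers [TopologicalSpace V] (𝒜 : Finset (Submodule K V)) : Set (Set V) :=
  {C | ∃ x ∈ complement 𝒜, C = connectedComponentIn (complement 𝒜) x}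

end Arrangement

section MidHyperplane

/-- The hyperplane `x_i = x_j` of `ℝ^m`. -/
def braidHyperplane (m : ℕ) (i j : Fin m) : Submodule ℝ (Fin m → ℝ) where
  carrier := {x | x i = x j}
  add_mem' {x y} hx hy := by
    simp only [Set.mem_ofPred_eq, Pi.add_apply] at *
    rw [hx, hy]
  zero_mem' := rfl
  smul_mem' c x hx := by
    simp only [Set.mem_ofPred_eq, Pi.smul_apply] at *
    rw [hx]

/-- The hyperplane `x_p + x_q = x_r + x_s` of `ℝ^m`. -/
def midHyperplane (m : ℕ) (p q r s : Fin m) : Submodule ℝ (Fin m → ℝ) where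
  carrier := {x | x p + x q = x r + x s}
  add_mem' {x y} hx hy := by
    simp only [Set.mem_ofPred_eq, Pi.add_apply] at *
    linarith
  zero_mem' := rfl
  smul_mem' c x hx := by
    simp only [Set.mem_ofPred_eq, Pi.smul_apply, smul_eq_mul] at *
    rw [← mul_add, ← mul_add, hx]

open Classical in
/-- The braid arrangement `ℬ_m`. -/
noncomputable def braidArrangement (m : ℕ) : Finset (Submodule ℝ (Fin m → ℝ)) :=
  (Finset.univ.filter fun a : Fin m × Fin m => a.1 < a.2).image
    fun a => braidHyperplane m a.1 a.2

/-- The set `I₄` of quadruples `(p, q, r, s)` of distinct indices with `p < q`, `p < r < s`. -/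
def quadruples (m : ℕ) : Finset (Fin m × Fin m × Fin m × Fin m) :=
  Finset.univ.filter fun (p, q, r, s) => p < q ∧ p < r ∧ r < s ∧ [p, q, r, s].Nodup

open Classical in
/-- The mid-hyperplane arrangement `𝒜_m`. -/
noncomputable def midArrangement (m : ℕ) : Finset (Submodule ℝ (Fin m → ℝ)) :=
  braidArrangement m ∪ (quadruples m).image fun (p, q, r, s) => midHyperplane m p q r s

end MidHyperplane

section Ranking

variable {m : ℕ}

/-- The set `R(x)`: the real line without the midpoints `(x_i + x_j) / 2`, `i < j`. -/
def nonMidpoints (x : Fin m → ℝ) : Set ℝ :=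
  {y | ∀ i j : Fin m, i < j → y ≠ (x i + x j) / 2}

/-- The ranking map of `x`: it sends `y` to the permutation `k ↦ i_k` that lists the objects by
increasing distance from `y`. -/
noncomputable def rankingMap (x : Fin m → ℝ) (y : nonMidpoints x) : Equiv.Perm (Fin m) :=
  Tuple.sort fun i => |(y : ℝ) - x i|

/-- For `x ∈ M(𝒜_m)`, the ranking map takes the value `(i_1 … i_m)` at `y` if and only if
`|y - x_{i_1}| < … < |y - x_{i_m}|`. -/
theorem rankingMap_eq_iff (x : Fin m → ℝ) (hx : x ∈ complement (midArrangement m))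
    (y : nonMidpoints x) (π : Equiv.Perm (Fin m)) :
    rankingMap x y = π ↔ StrictMono fun k => |(y : ℝ) - x (π k)| := by
  have hlt : ∀ i j : Fin m, i < j → |(y : ℝ) - x i| ≠ |(y : ℝ) - x j| := by
    intro i j hij h
    rcases abs_eq_abs.1 h with h | h
    · refine hx (braidHyperplane m i j) ?_ (show x i = x j by linarith)
      exact Finset.mem_union_left _
        (Finset.mem_image.2 ⟨(i, j), by simpa using hij, rfl⟩)
    · exact y.2 i j hij (by linarith)
  have hinj : Function.Injective fun i => |(y : ℝ) - x i| := by
    intro i j h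
    rcases lt_trichotomy i j with hij | hij | hij
    · exact absurd h (hlt i j hij)
    · exact hij
    · exact absurd h.symm (hlt j i hij)
  constructor
  · rintro rfl
    exact (Tuple.monotone_sort fun i => |(y : ℝ) - x i|).strictMono_of_injective
      (hinj.comp (Equiv.injective _))
  · intro h
    have h2 := Tuple.unique_monotone (f := fun i => |(y : ℝ) - x i|) (σ := rankingMap x y)
      (τ := π) (Tuple.monotone_sort _) h.monotone
    ext k
    exact congrArg Fin.val (hinj (congrFun h2 k))

/-- The ranking pattern of `x`: the image of the ranking map of `x`. -/
def rankingPattern (x : Fin m → ℝ) : Set (Equiv.Perm (Fin m)) :=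
  Set.range (rankingMap x)

/-- The number `r(m)` of ranking patterns of the `x ∈ M(𝒜_m)` with `x_1 < … < x_m`. -/
noncomputable def numRankingPatterns (m : ℕ) : ℕ :=
  (rankingPattern '' {x : Fin m → ℝ | StrictMono x ∧ x ∈ complement (midArrangement m)}).ncard

end Ranking

end RankingPattern

open RankingPattern Polynomial

/-! Everything follows from the characteristic polynomial. By Zaslavsky's theorem the number of
chambers is `(-1)^m χ(-1)`. For a sorted point the ranking pattern records exactly the order of the
midpoints, that is, the chamber of the point. Permuting coordinates moves every chamber to `m!`
different ones, one for each order of the coordinates, so `m! r(m)` is the number of chambers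
(`factorial_mul_numRankingPatterns`).

The polynomial is found by the finite field method. By Whitney's formula `χ(t) = ∑ (-1)^|B| t^(dim
⋂B)`, and inclusion-exclusion gives the same expression for the number of points of `F_q^m` off all
hyperplanes, provided that every intersection has the same dimension over `ℝ` and over `F_q`. This
holds when `q ∤ m` and `4^(m-1) < m q²`: the ranks are decided by determinants with one row of ones
and other rows of sum `0` and norm at most `2`; such a determinant is divisible by `m` and has
square at most `4^(m-1) m` by Hadamard, so if it is nonzero then `q` cannot divide it
(`det_cast_ne_zero`).

The points to be counted are the orderings of `m`-element weak Sidon sets in `F_q`. Affine maps act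
simply transitively on ordered pairs of distinct elements, so only the sets that contain `0` and `1`
need counting. A backtracking search on bit masks counts them; it is proved correct in `extCount_eq`
and evaluated in the kernel. Since `χ` is monic of degree `m` and vanishes at `0` and `1`, its
values at `m - 2` primes determine it. -/

namespace RankingPattern

/-! ### Whitney's formula for the characteristic polynomial -/

section Whitney
variable {K V ι : Type*} [Field K] [AddCommGroup V] [Module K V]

theorem sum_neg_one_pow_card_eq_ite [DecidableEq ι] (s : Finset ι) :
    ∑ B ∈ s.powerset, (-1 : ℤ) ^ B.card = if s = ∅ then 1 else 0 := by
  simpa using Finset.sum_powerset_neg_one_pow_card (x := s)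

theorem inf_image_eq {ι : Type*} [DecidableEq (Submodule K V)] (B : Finset ι)
    (H : ι → Submodule K V) : (B.image H).inf id = B.inf H := by
  rw [Finset.inf_image]; rfl

/-- An intersection of hyperplanes, as an element of the intersection poset. -/
def edge [DecidableEq (Submodule K V)] (I : Finset ι) (H : ι → Submodule K V)
    (B : I.powerset) : IntersectionPoset (I.image H) :=
  OrderDual.toDual ⟨(B : Finset ι).inf H, (B : Finset ι).image H,
    Finset.image_subset_image (Finset.mem_powerset.1 B.2), (inf_image_eq _ _).symm⟩

/-- Uniqueness in Möbius inversion, by well-founded induction: the value at `x` is the sum up to `x`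
minus values already known to agree. -/
theorem eq_of_sum_le_eq {P : Type*} [Fintype P] [PartialOrder P] [DecidableLE P]
    (f g : P → ℤ) (h : ∀ x, ∑ y with y ≤ x, f y = ∑ y with y ≤ x, g y) : f = g := by
  classical
  funext x
  induction x using WellFoundedLT.induction with
  | ind x ih =>
    have key : ∀ f : P → ℤ, ∑ y with y ≤ x, f y = f x + ∑ y with y < x, f y := by
      intro f
      rw [← Finset.sum_insert (by simp)]
      refine Finset.sum_congr ?_ fun _ _ => rfl
      ext y
      simp [le_iff_eq_or_lt]
    have h1 := h x
    rw [key, key, Finset.sum_congr rfl fun y hy => ih y (by simpa using hy)] at h1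
    linarith

/-- Both sides have the same sums over `Y ≤ X`. On the right such a sum runs over all subsets of `{i
| X ≤ H i}`, so it vanishes unless that set is empty, which happens only for `X = V`. Repetitions in
the family `H` do no harm. -/
theorem moebius_eq_sum [DecidableEq (Submodule K V)] (I : Finset ι) (H : ι → Submodule K V)
    (hH : ∀ i ∈ I, H i ≠ ⊤) (X : IntersectionPoset (I.image H)) :
    moebius (I.image H) X =
      ∑ B ∈ I.powerset with B.inf H = X.space, (-1 : ℤ) ^ B.card := by
  classical
  revert X
  refine congrFun (eq_of_sum_le_eq _ _ fun X => ?_)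
  have hR : ∑ Y with Y ≤ X, ∑ B ∈ I.powerset with B.inf H = Y.space, (-1 : ℤ) ^ B.card
      = if (I.filter fun i => X.space ≤ H i) = ∅ then 1 else 0 := by
    rw [← sum_neg_one_pow_card_eq_ite, ← Finset.sum_biUnion]
    · refine Finset.sum_congr ?_ fun _ _ => rfl
      ext B
      simp only [Finset.mem_biUnion, Finset.mem_filter, Finset.mem_univ, true_and,
        Finset.mem_powerset, Finset.subset_iff]
      constructor
      · rintro ⟨Y, hYX, hB, hBY⟩ i hi
        refine ⟨hB hi, ?_⟩
        rw [IntersectionPoset.le_iff, ← hBY] at hYX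
        exact hYX.trans (Finset.inf_le hi)
      · intro h
        refine ⟨edge I H ⟨B, Finset.mem_powerset.2 fun i hi => (h hi).1⟩, ?_,
          fun i hi => (h hi).1, rfl⟩
        rw [IntersectionPoset.le_iff]
        exact Finset.le_inf fun i hi => (h hi).2
    · intro Y _ Z _ hYZ
      rw [Function.onFun, Finset.disjoint_left]
      intro B hB hB'
      simp only [Finset.mem_filter] at hB hB'
      exact hYZ (OrderDual.ofDual.injective (Subtype.ext (hB.2.symm.trans hB'.2)))
  rw [hR]
  by_cases hX : X = IntersectionPoset.whole (I.image H)
  · subst hX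
    have h1 : (Finset.univ.filter fun Y => Y ≤ IntersectionPoset.whole (I.image H))
        = {IntersectionPoset.whole (I.image H)} := by
      ext Y
      simp only [Finset.mem_filter, Finset.mem_univ, true_and, Finset.mem_singleton]
      constructor
      · intro h
        exact le_antisymm h ((IntersectionPoset.le_iff _ _).2 (show Y.space ≤ ⊤ from le_top))
      · rintro rfl
        exact le_rfl
    rw [h1, Finset.sum_singleton, moebius_whole, if_pos]
    refine Finset.filter_eq_empty_iff.2 fun i hi h => hH i hi ?_
    exact top_le_iff.1 h
  · rw [if_neg]
    · convert sum_moebius (I.image H) X hX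
    · intro hE
      apply hX
      obtain ⟨ℬ, hℬ, hXB⟩ := (OrderDual.ofDual X).2
      refine OrderDual.ofDual.injective (Subtype.ext ?_)
      change X.space = ⊤
      change X.space = _ at hXB
      rw [hXB, Finset.inf_eq_top_iff]
      intro W hW
      obtain ⟨i, hi, rfl⟩ := Finset.mem_image.1 (hℬ hW)
      refine absurd (Finset.mem_filter.2 ⟨hi, ?_⟩) (hE ▸ Finset.notMem_empty i)
      rw [hXB]
      exact Finset.inf_le (f := id) hW

/-- Whitney's formula for the characteristic polynomial of an arrangement. -/
theorem charPoly_image_eq_sum [DecidableEq (Submodule K V)] (I : Finset ι)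
    (H : ι → Submodule K V) (hH : ∀ i ∈ I, H i ≠ ⊤) :
    charPoly (I.image H) = ∑ B ∈ I.powerset,
      Polynomial.C ((-1 : ℤ) ^ B.card) * Polynomial.X ^ Module.finrank K ↥(B.inf H) := by
  classical
  have h : ∀ Y : IntersectionPoset (I.image H),
      Polynomial.C (moebius (I.image H) Y) * Polynomial.X ^ Module.finrank K Y.space =
      ∑ B : I.powerset with edge I H B = Y, Polynomial.C ((-1 : ℤ) ^ (B : Finset ι).card) *
        Polynomial.X ^ Module.finrank K ↥((B : Finset ι).inf H) := by
    intro Y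
    rw [moebius_eq_sum I H hH, map_sum, Finset.sum_mul, Finset.sum_filter, Finset.sum_filter,
      ← Finset.sum_coe_sort I.powerset]
    refine Finset.sum_congr rfl fun B _ => ?_
    have : edge I H B = Y ↔ (B : Finset ι).inf H = Y.space :=
      ⟨fun h => h ▸ rfl, fun h => OrderDual.ofDual.injective (Subtype.ext h)⟩
    by_cases hB : (B : Finset ι).inf H = Y.space
    · rw [if_pos hB, if_pos (this.2 hB), hB]
    · rw [if_neg hB, if_neg (this.not.2 hB)]
  rw [charPoly, Finset.sum_congr rfl fun Y _ => h Y, ← Finset.sum_coe_sort I.powerset]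
  exact Finset.sum_fiberwise _ _ _

end Whitney

/-- Chambers, sign vectors and ranking patterns are all images of points of the complement; their
numbers are compared by checking that two maps identify the same points. -/
theorem ncard_image_eq_ncard_image {α β γ : Type*} {s : Set α} {g : α → β} {h : α → γ}
    (H : ∀ x ∈ s, ∀ y ∈ s, g x = g y ↔ h x = h y) : (g '' s).ncard = (h '' s).ncard := by
  refine Set.ncard_congr (fun b hb => h hb.choose) ?_ ?_ ?_
  · intro b hb
    exact ⟨_, hb.choose_spec.1, rfl⟩
  · intro b c hb hc hbc
    rw [← H _ hb.choose_spec.1 _ hc.choose_spec.1] at hbc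
    rw [← hb.choose_spec.2, ← hc.choose_spec.2, hbc]
  · rintro _ ⟨x, hx, rfl⟩
    have hgx : g x ∈ g '' s := ⟨x, hx, rfl⟩
    exact ⟨g x, hgx, (H _ hgx.choose_spec.1 _ hx).1 hgx.choose_spec.2⟩

/-! ### Sign vectors, chambers and Zaslavsky's theorem -/

section Zaslavsky
variable {V ι : Type*} [AddCommGroup V] [Module ℝ V]

/-- The indices of the functionals that are positive at `x`. -/
noncomputable def posSet (I : Finset ι) (f : ι → V →ₗ[ℝ] ℝ) (x : V) : Finset ι :=
  I.filter fun i => 0 < f i x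

theorem posSet_eq_iff {I : Finset ι} {f : ι → V →ₗ[ℝ] ℝ} {x y : V} :
    posSet I f x = posSet I f y ↔ ∀ i ∈ I, (0 < f i x ↔ 0 < f i y) := by
  simp only [posSet, Finset.ext_iff, Finset.mem_filter]
  exact ⟨fun h i hi => by simpa [hi] using h i, fun h i => and_congr_right (h i)⟩

/-- The sign vectors that the functionals `f i`, `i ∈ I`, realize on `W`. -/
def signVectors (I : Finset ι) (f : ι → V →ₗ[ℝ] ℝ) (W : Submodule ℝ V) : Set (Finset ι) :=
  posSet I f '' {x | x ∈ W ∧ ∀ i ∈ I, f i x ≠ 0}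

theorem signVectors_finite (I : Finset ι) (f : ι → V →ₗ[ℝ] ℝ) (W : Submodule ℝ V) :
    (signVectors I f W).Finite := by
  refine I.powerset.finite_toSet.subset ?_
  rintro _ ⟨x, -, rfl⟩
  exact Finset.mem_coe.2 (Finset.mem_powerset.2 (Finset.filter_subset _ _))

theorem pos_iff_pos_of_combination {a b s t : ℝ} (hs : 0 < s) (ht : 0 < t) (ha : a ≠ 0)
    (hb : b ≠ 0) (h : 0 < a ↔ 0 < b) : s * a + t * b ≠ 0 ∧ (0 < s * a + t * b ↔ 0 < a) := by
  rcases ha.lt_or_gt with ha | ha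
  · have hb' : b < 0 := by
      rcases hb.lt_or_gt with hb | hb
      · exact hb
      · exact absurd (h.2 hb) ha.not_gt
    have h1 := mul_neg_of_pos_of_neg hs ha
    have h2 := mul_neg_of_pos_of_neg ht hb'
    constructor
    · linarith
    · constructor <;> intro <;> linarith
  · have hb' := h.1 ha
    have h1 := mul_pos hs ha
    have h2 := mul_pos ht hb'
    constructor
    · linarith
    · constructor <;> intro <;> linarith

/-- Finitely many strict inequalities survive a small move, so a point on one further hyperplane can
be pushed off it without changing the other signs. -/
theorem exists_pos_forall_sign_eq (I : Finset ι) (f : ι → V →ₗ[ℝ] ℝ) (x v : V)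
    (hx : ∀ i ∈ I, f i x ≠ 0) :
    ∃ t : ℝ, 0 < t ∧ ∀ i ∈ I, f i (x + t • v) ≠ 0 ∧ (0 < f i (x + t • v) ↔ 0 < f i x) := by
  have h : ∀ i ∈ I, ∀ᶠ t : ℝ in nhdsWithin 0 (Set.Ioi 0),
      f i (x + t • v) ≠ 0 ∧ (0 < f i (x + t • v) ↔ 0 < f i x) := by
    intro i hi
    refine Filter.Eventually.filter_mono nhdsWithin_le_nhds ?_
    have hc : Continuous fun t : ℝ => f i (x + t • v) := by
      simp only [map_add, map_smul, smul_eq_mul]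
      fun_prop
    have h0 : f i (x + (0 : ℝ) • v) = f i x := by simp
    rcases (hx i hi).lt_or_gt with hlt | hgt
    · filter_upwards [hc.continuousAt.eventually (gt_mem_nhds (h0 ▸ hlt))] with t ht
      exact ⟨ht.ne, fun h => absurd h ht.not_gt, fun h => absurd h hlt.not_gt⟩
    · filter_upwards [hc.continuousAt.eventually (lt_mem_nhds (h0 ▸ hgt))] with t ht
      exact ⟨ht.ne', fun _ => hgt, fun _ => ht⟩
  obtain ⟨t, h1, h2⟩ := (((Filter.eventually_all_finset I).2 h).and
    self_mem_nhdsWithin).exists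
  exact ⟨t, h2, h1⟩

/-- Deletion and restriction. Let `P` and `N` be the sign vectors of `I` realized on the two open
sides of the new hyperplane. The new count is `|P| + |N| = |P ∪ N| + |P ∩ N|`; the union is
everything realized on `W`, the intersection is what is realized on the hyperplane itself. -/
theorem ncard_signVectors_insert [DecidableEq ι] {I : Finset ι} {a : ι} (ha : a ∉ I)
    (f : ι → V →ₗ[ℝ] ℝ) (W : Submodule ℝ V) (hW : ¬ W ≤ LinearMap.ker (f a)) :
    (signVectors (insert a I) f W).ncard =
      (signVectors I f W).ncard + (signVectors I f (W ⊓ LinearMap.ker (f a))).ncard := by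
  set P : Set (Finset ι) :=
    posSet I f '' {x | (x ∈ W ∧ ∀ i ∈ I, f i x ≠ 0) ∧ 0 < f a x} with hP
  set N : Set (Finset ι) :=
    posSet I f '' {x | (x ∈ W ∧ ∀ i ∈ I, f i x ≠ 0) ∧ f a x < 0} with hN
  have haP : ∀ x, a ∉ posSet I f x := fun x h => ha (Finset.mem_filter.1 h).1
  have hPsub : P ⊆ signVectors I f W := Set.image_mono fun x hx => hx.1
  have hNsub : N ⊆ signVectors I f W := Set.image_mono fun x hx => hx.1
  have hPf : P.Finite := (signVectors_finite I f W).subset hPsub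
  have hNf : N.Finite := (signVectors_finite I f W).subset hNsub
  have h1 : signVectors (insert a I) f W = insert a '' P ∪ N := by
    ext s
    constructor
    · rintro ⟨x, ⟨hxW, hx⟩, rfl⟩
      have hx' : ∀ i ∈ I, f i x ≠ 0 := fun i hi => hx i (Finset.mem_insert_of_mem hi)
      rcases (hx a (Finset.mem_insert_self _ _)).lt_or_gt with h | h
      · right
        refine ⟨x, ⟨⟨hxW, hx'⟩, h⟩, ?_⟩
        simp [posSet, Finset.filter_insert, h.not_gt]
      · left
        refine ⟨_, ⟨x, ⟨⟨hxW, hx'⟩, h⟩, rfl⟩, ?_⟩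
        simp [posSet, Finset.filter_insert, h]
    · rintro (⟨_, ⟨x, ⟨⟨hxW, hx⟩, h⟩, rfl⟩, rfl⟩ | ⟨x, ⟨⟨hxW, hx⟩, h⟩, rfl⟩)
      · refine ⟨x, ⟨hxW, ?_⟩, ?_⟩
        · simpa [h.ne'] using hx
        · simp [posSet, Finset.filter_insert, h]
      · refine ⟨x, ⟨hxW, ?_⟩, ?_⟩
        · simpa [h.ne] using hx
        · simp [posSet, Finset.filter_insert, h.not_gt]
  have h2 : P ∪ N = signVectors I f W := by
    refine (Set.union_subset hPsub hNsub).antisymm ?_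
    rintro _ ⟨x, ⟨hxW, hx⟩, rfl⟩
    rcases lt_trichotomy (f a x) 0 with h | h | h
    · exact Or.inr ⟨x, ⟨⟨hxW, hx⟩, h⟩, rfl⟩
    · obtain ⟨v, hvW, hv⟩ := SetLike.not_le_iff_exists.1 hW
      rw [LinearMap.mem_ker] at hv
      obtain ⟨t, ht, hxt⟩ := exists_pos_forall_sign_eq I f x v hx
      have hs : posSet I f (x + t • v) = posSet I f x :=
        posSet_eq_iff.2 fun i hi => (hxt i hi).2
      have hmem : x + t • v ∈ W := W.add_mem hxW (W.smul_mem _ hvW)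
      rcases lt_or_gt_of_ne hv with hv | hv
      · refine Or.inr ⟨_, ⟨⟨hmem, fun i hi => (hxt i hi).1⟩, ?_⟩, hs⟩
        simpa [h] using mul_neg_of_pos_of_neg ht hv
      · refine Or.inl ⟨_, ⟨⟨hmem, fun i hi => (hxt i hi).1⟩, ?_⟩, hs⟩
        simpa [h] using mul_pos ht hv
    · exact Or.inl ⟨x, ⟨⟨hxW, hx⟩, h⟩, rfl⟩
  have h3 : P ∩ N = signVectors I f (W ⊓ LinearMap.ker (f a)) := by
    ext s
    constructor
    · rintro ⟨⟨x, ⟨⟨hxW, hx⟩, hxa⟩, rfl⟩, ⟨y, ⟨⟨hyW, hy⟩, hya⟩, hxy⟩⟩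
      have key : ∀ i ∈ I, _ := fun i hi => pos_iff_pos_of_combination (neg_pos.2 hya) hxa
        (hx i hi) (hy i hi) (posSet_eq_iff.1 hxy i hi).symm
      -- Up to a positive factor, this is where the segment from `x` to `y` crosses the hyperplane;
      -- both coefficients are positive, so the common signs persist.
      refine ⟨(-f a y) • x + f a x • y, ⟨⟨W.add_mem (W.smul_mem _ hxW) (W.smul_mem _ hyW), ?_⟩,
        fun i hi => ?_⟩, posSet_eq_iff.2 fun i hi => ?_⟩
      · rw [SetLike.mem_coe, LinearMap.mem_ker]
        simp only [map_add, map_smul, smul_eq_mul]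
        ring
      · simpa using (key i hi).1
      · simpa using (key i hi).2
    · rintro ⟨x, ⟨⟨hxW, hxa⟩, hx⟩, rfl⟩
      obtain ⟨v, hvW, hv⟩ := SetLike.not_le_iff_exists.1 hW
      have hxa' : f a x = 0 := hxa
      have main : ∀ w ∈ W, 0 < f a w → posSet I f x ∈ P ∧ posSet I f x ∈ N := by
        intro w hw hwa
        obtain ⟨t, ht, hxt⟩ := exists_pos_forall_sign_eq I f x w hx
        obtain ⟨u, hu, hxu⟩ := exists_pos_forall_sign_eq I f x (-w) hx
        refine ⟨⟨x + t • w, ⟨⟨W.add_mem hxW (W.smul_mem _ hw), fun i hi => (hxt i hi).1⟩, ?_⟩,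
          posSet_eq_iff.2 fun i hi => (hxt i hi).2⟩,
          ⟨x + u • -w, ⟨⟨W.add_mem hxW (W.smul_mem _ (W.neg_mem hw)),
            fun i hi => (hxu i hi).1⟩, ?_⟩, posSet_eq_iff.2 fun i hi => (hxu i hi).2⟩⟩
        · simpa [hxa'] using mul_pos ht hwa
        · simpa [hxa'] using mul_pos hu hwa
      rw [LinearMap.mem_ker] at hv
      rcases lt_or_gt_of_ne hv with hv | hv
      · exact main (-v) (W.neg_mem hvW) (by simpa using hv)
      · exact main v hvW hv
  have hinj : Set.InjOn (insert a) P := by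
    rintro _ ⟨x, -, rfl⟩ _ ⟨y, -, rfl⟩ h
    rw [← Finset.erase_insert (haP x), h, Finset.erase_insert (haP y)]
  have hdisj : Disjoint (insert a '' P) N := by
    rw [Set.disjoint_left]
    rintro _ ⟨s, -, rfl⟩ ⟨y, -, hy⟩
    exact haP y (hy ▸ Finset.mem_insert_self _ _)
  rw [h1, Set.ncard_union_eq hdisj (hPf.image _) hNf, hinj.ncard_image,
    ← Set.ncard_union_add_ncard_inter P N hPf hNf, h2, h3]

theorem finrank_inf_ker_add_one [FiniteDimensional ℝ V] (W : Submodule ℝ V) (g : V →ₗ[ℝ] ℝ)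
    (hW : ¬ W ≤ LinearMap.ker g) :
    Module.finrank ℝ ↥(W ⊓ LinearMap.ker g) + 1 = Module.finrank ℝ W := by
  have hne : g.domRestrict W ≠ 0 := by
    intro h
    exact hW fun x hx => LinearMap.mem_ker.2 (by simpa using LinearMap.congr_fun h ⟨x, hx⟩)
  have h1 := Module.Dual.finrank_ker_add_one_of_ne_zero (f := g.domRestrict W) hne
  rw [← h1, LinearMap.ker_domRestrict, ← Submodule.map_comap_subtype]
  congr 1
  exact (W.equivSubtypeMap _).finrank_eq.symm

/-- **Zaslavsky's theorem** for sign vectors. -/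
theorem ncard_signVectors [FiniteDimensional ℝ V] (I : Finset ι) (f : ι → V →ₗ[ℝ] ℝ)
    (W : Submodule ℝ V) :
    ((signVectors I f W).ncard : ℤ) = (-1) ^ Module.finrank ℝ W *
      ∑ B ∈ I.powerset, (-1) ^ B.card *
        (-1) ^ Module.finrank ℝ ↥(W ⊓ B.inf fun i => LinearMap.ker (f i)) := by
  classical
  induction I using Finset.induction generalizing W with
  | empty =>
    have : signVectors ∅ f W = {∅} := by
      ext s
      simp only [signVectors, posSet, Finset.filter_empty, Set.mem_image, Set.mem_singleton_iff]
      constructor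
      · rintro ⟨x, -, rfl⟩; rfl
      · rintro rfl; exact ⟨0, ⟨W.zero_mem, by simp⟩, rfl⟩
    rw [this, Finset.powerset_empty, Finset.sum_singleton, Finset.inf_empty, inf_top_eq,
      Finset.card_empty, pow_zero, one_mul, ← mul_pow, Set.ncard_singleton]
    simp
  | insert a I ha ih =>
    have hcard : ∀ B ∈ I.powerset, (insert a B).card = B.card + 1 := fun B hB =>
      Finset.card_insert_of_notMem fun h => ha (Finset.mem_powerset.1 hB h)
    rw [Finset.sum_powerset_insert ha]
    -- If `f a` vanishes on `W`, no point is admissible and the terms of `B` and `insert a B`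
    -- cancel. Otherwise restriction lowers the dimension by one, which supplies the sign of the
    -- terms with `a`.
    by_cases hW : W ≤ LinearMap.ker (f a)
    · have : signVectors (insert a I) f W = ∅ := by
        refine Set.image_eq_empty.2 (Set.eq_empty_iff_forall_notMem.2 ?_)
        rintro x ⟨hx, h⟩
        exact h a (Finset.mem_insert_self _ _) (hW hx)
      rw [this, ← Finset.sum_add_distrib, Finset.sum_eq_zero]
      · simp
      · intro B hB
        rw [hcard B hB, Finset.inf_insert, ← inf_assoc, inf_eq_left.2 hW]
        ring
    · rw [ncard_signVectors_insert ha f W hW, Nat.cast_add, ih, ih,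
        ← finrank_inf_ker_add_one W (f a) hW, mul_add]
      congr 1
      rw [pow_succ, mul_assoc]
      congr 1
      rw [Finset.mul_sum]
      refine Finset.sum_congr rfl fun B hB => ?_
      rw [hcard B hB, Finset.inf_insert, ← inf_assoc]
      ring

/-- A functional without zeros on a connected set keeps its sign there; conversely, the segment
between two points with equal signs avoids every hyperplane. -/
theorem connectedComponentIn_eq_iff_posSet_eq [TopologicalSpace V] [IsTopologicalAddGroup V]
    [ContinuousSMul ℝ V] [T2Space V] [FiniteDimensional ℝ V]
    (I : Finset ι) (f : ι → V →ₗ[ℝ] ℝ) {x y : V}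
    (hx : ∀ i ∈ I, f i x ≠ 0) (hy : ∀ i ∈ I, f i y ≠ 0) :
    connectedComponentIn {z | ∀ i ∈ I, f i z ≠ 0} x =
      connectedComponentIn {z | ∀ i ∈ I, f i z ≠ 0} y ↔ posSet I f x = posSet I f y := by
  rw [posSet_eq_iff]
  constructor
  · intro h i hi
    set C := connectedComponentIn {z | ∀ i ∈ I, f i z ≠ 0} x with hC
    have hxC : x ∈ C := mem_connectedComponentIn hx
    have hyC : y ∈ C := h ▸ mem_connectedComponentIn hy
    have hne : ∀ z ∈ C, f i z ≠ 0 := fun z hz => connectedComponentIn_subset _ _ hz i hi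
    have hpre : IsPreconnected (f i '' C) := isPreconnected_connectedComponentIn.image _
      (LinearMap.continuous_of_finiteDimensional _).continuousOn
    have key : ∀ u ∈ C, ∀ v ∈ C, 0 < f i u → 0 < f i v := by
      intro u hu v hv h
      by_contra hneg
      obtain ⟨z, hz, hz0⟩ := hpre.Icc_subset ⟨v, hv, rfl⟩ ⟨u, hu, rfl⟩ ⟨not_lt.1 hneg, h.le⟩
      exact hne z hz hz0
    exact ⟨key x hxC y hyC, key y hyC x hxC⟩
  · intro h
    refine connectedComponentIn_eq ?_
    have hsub : segment ℝ x y ⊆ {z | ∀ i ∈ I, f i z ≠ 0} := by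
      rintro _ ⟨s, t, hs, ht, hst, rfl⟩ i hi
      rcases hs.eq_or_lt with rfl | hs
      · simpa [show t = 1 by linarith] using hy i hi
      rcases ht.eq_or_lt with rfl | ht
      · simpa [show s = 1 by linarith] using hx i hi
      simpa using (pos_iff_pos_of_combination hs ht (hx i hi) (hy i hi) (h i hi)).1
    exact (convex_segment x y).isPreconnected.subset_connectedComponentIn
      (left_mem_segment ℝ x y) hsub (right_mem_segment ℝ x y)

theorem mem_complement_image_ker [DecidableEq (Submodule ℝ V)] {I : Finset ι}
    {f : ι → V →ₗ[ℝ] ℝ} {x : V} :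
    x ∈ complement (I.image fun i => LinearMap.ker (f i)) ↔ ∀ i ∈ I, f i x ≠ 0 := by
  simp [complement]

theorem chambers_ncard_eq [TopologicalSpace V] [IsTopologicalAddGroup V] [ContinuousSMul ℝ V]
    [T2Space V] [FiniteDimensional ℝ V] [DecidableEq (Submodule ℝ V)] (I : Finset ι)
    (f : ι → V →ₗ[ℝ] ℝ) :
    (chambers (I.image fun i => LinearMap.ker (f i))).ncard = (signVectors I f ⊤).ncard := by
  have hS : complement (I.image fun i => LinearMap.ker (f i)) = {z | ∀ i ∈ I, f i z ≠ 0} :=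
    Set.ext fun x => mem_complement_image_ker
  have h1 : chambers (I.image fun i => LinearMap.ker (f i)) =
      connectedComponentIn {z | ∀ i ∈ I, f i z ≠ 0} '' {z | ∀ i ∈ I, f i z ≠ 0} := by
    ext C
    simp only [chambers, hS, Set.mem_image, Set.mem_ofPred_eq]
    exact exists_congr fun x => and_congr_right fun _ => eq_comm
  have h2 : signVectors I f ⊤ = posSet I f '' {z | ∀ i ∈ I, f i z ≠ 0} := by
    simp [signVectors]
  rw [h1, h2]
  exact ncard_image_eq_ncard_image fun x hx y hy =>
    connectedComponentIn_eq_iff_posSet_eq I f hx hy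

/-- **Zaslavsky's theorem**: the number of chambers is `|χ(-1)|`. -/
theorem chambers_ncard_eq_eval [TopologicalSpace V] [IsTopologicalAddGroup V]
    [ContinuousSMul ℝ V] [T2Space V] [FiniteDimensional ℝ V] [DecidableEq (Submodule ℝ V)]
    (I : Finset ι) (f : ι → V →ₗ[ℝ] ℝ) (hf : ∀ i ∈ I, f i ≠ 0) :
    ((chambers (I.image fun i => LinearMap.ker (f i))).ncard : ℤ) =
      (-1) ^ Module.finrank ℝ V *
        (charPoly (I.image fun i => LinearMap.ker (f i))).eval (-1) := by
  rw [chambers_ncard_eq, ncard_signVectors, charPoly_image_eq_sum]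
  · simp only [Polynomial.eval_finsetSum, finrank_top, Polynomial.eval_mul, Polynomial.eval_C,
      Polynomial.eval_pow, Polynomial.eval_X]
    exact congrArg _ (Finset.sum_congr rfl fun B _ => by rw [top_inf_eq])
  · intro i hi h
    exact hf i hi (LinearMap.ker_eq_top.1 h)

end Zaslavsky

/-! ### The hyperplanes as integer coefficient vectors, usable over every ring -/

section MidVectors
variable {m : ℕ} {K : Type*} [CommRing K]

/-- The linear form with integer coefficients `c`. -/
def form (K : Type*) [CommRing K] (c : Fin m → ℤ) : (Fin m → K) →ₗ[K] K :=
  ∑ i, (c i : K) • LinearMap.proj i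

theorem form_apply (c : Fin m → ℤ) (x : Fin m → K) : form K c x = ∑ i, (c i : K) * x i := by
  simp [form]

/-- The coefficients of `x_i - x_j`. -/
def braidVector (i j : Fin m) : Fin m → ℤ := Pi.single i 1 - Pi.single j 1

/-- The coefficients of `x_p + x_q - x_r - x_s`. -/
def midVector (p q r s : Fin m) : Fin m → ℤ :=
  Pi.single p 1 + Pi.single q 1 - Pi.single r 1 - Pi.single s 1

theorem sum_single_mul (i : Fin m) (x : Fin m → K) :
    ∑ k, (((Pi.single i 1 : Fin m → ℤ) k : ℤ) : K) * x k = x i := by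
  rw [Finset.sum_eq_single i]
  · simp
  · intro k _ hk
    simp [hk]
  · simp

theorem form_braidVector (i j : Fin m) (x : Fin m → K) :
    form K (braidVector i j) x = x i - x j := by
  simp only [form_apply, braidVector, Pi.sub_apply, Int.cast_sub, sub_mul,
    Finset.sum_sub_distrib, sum_single_mul]

theorem form_midVector (p q r s : Fin m) (x : Fin m → K) :
    form K (midVector p q r s) x = x p + x q - x r - x s := by
  simp only [form_apply, midVector, Pi.sub_apply, Pi.add_apply, Int.cast_sub, Int.cast_add,
    sub_mul, add_mul, Finset.sum_sub_distrib, Finset.sum_add_distrib, sum_single_mul]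

/-- The coefficient vectors of the hyperplanes of the mid-hyperplane arrangement. -/
def midVectors (m : ℕ) : Finset (Fin m → ℤ) :=
  ((Finset.univ.filter fun a : Fin m × Fin m => a.1 < a.2).image fun a =>
    braidVector a.1 a.2) ∪
  (quadruples m).image fun (p, q, r, s) => midVector p q r s

theorem mem_midVectors {c : Fin m → ℤ} : c ∈ midVectors m ↔
    (∃ i j, i < j ∧ braidVector i j = c) ∨
    ∃ p q r s, (p < q ∧ p < r ∧ r < s ∧ [p, q, r, s].Nodup) ∧ midVector p q r s = c := by
  simp [midVectors, quadruples]

theorem braidHyperplane_eq (i j : Fin m) :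
    braidHyperplane m i j = LinearMap.ker (form ℝ (braidVector i j)) := by
  ext x
  rw [LinearMap.mem_ker, form_braidVector, sub_eq_zero]
  rfl

theorem midHyperplane_eq (p q r s : Fin m) :
    midHyperplane m p q r s = LinearMap.ker (form ℝ (midVector p q r s)) := by
  ext x
  rw [LinearMap.mem_ker, form_midVector, sub_sub, sub_eq_zero]
  rfl

open Classical in
theorem midArrangement_eq (m : ℕ) :
    midArrangement m = (midVectors m).image fun c => LinearMap.ker (form ℝ c) := by
  rw [midArrangement, braidArrangement, midVectors, Finset.image_union, Finset.image_image,
    Finset.image_image]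
  congr 1
  · exact Finset.image_congr fun a _ => braidHyperplane_eq _ _
  · exact Finset.image_congr fun a _ => midHyperplane_eq _ _ _ _

/-- A symmetric property of four distinct indices may be tested on the quadruples. -/
theorem forall_nodup_of_quadruples {R : Fin m → Fin m → Fin m → Fin m → Prop}
    (h1 : ∀ p q r s, R p q r s → R q p r s) (h2 : ∀ p q r s, R p q r s → R p q s r)
    (h3 : ∀ p q r s, R p q r s → R r s p q)
    (h : ∀ p q r s, p < q ∧ p < r ∧ r < s ∧ [p, q, r, s].Nodup → R p q r s)
    (p q r s : Fin m) (hn : [p, q, r, s].Nodup) : R p q r s := by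
  have a3 : ∀ p q r s : Fin m, p < q → r < s → [p, q, r, s].Nodup → R p q r s := by
    intro p q r s hpq hrs hn
    rcases lt_trichotomy p r with hpr | hpr | hpr
    · exact h p q r s ⟨hpq, hpr, hrs, hn⟩
    · simp [hpr] at hn
    · exact h3 _ _ _ _ (h r s p q ⟨hrs, hpr, hpq, by simp at hn ⊢; tauto⟩)
  have a2 : ∀ p q r s : Fin m, p < q → [p, q, r, s].Nodup → R p q r s := by
    intro p q r s hpq hn
    rcases lt_trichotomy r s with hrs | hrs | hrs
    · exact a3 p q r s hpq hrs hn
    · simp [hrs] at hn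
    · exact h2 _ _ _ _ (a3 p q s r hpq hrs (by simp at hn ⊢; tauto))
  rcases lt_trichotomy p q with hpq | hpq | hpq
  · exact a2 p q r s hpq hn
  · simp [hpq] at hn
  · exact h1 _ _ _ _ (a2 q p r s hpq (by simp at hn ⊢; tauto))

theorem forall_form_ne_zero_iff {x : Fin m → K} :
    (∀ c ∈ midVectors m, form K c x ≠ 0) ↔
      Function.Injective x ∧ ∀ p q r s, [p, q, r, s].Nodup → x p + x q ≠ x r + x s := by
  constructor
  · intro h
    constructor
    · have key : ∀ i j : Fin m, i < j → x i ≠ x j := fun i j hij hx =>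
        h _ (mem_midVectors.2 (Or.inl ⟨i, j, hij, rfl⟩))
          (by rw [form_braidVector, hx, sub_self])
      intro i j hij
      rcases lt_trichotomy i j with h | h | h
      · exact absurd hij (key i j h)
      · exact h
      · exact absurd hij.symm (key j i h)
    · refine forall_nodup_of_quadruples ?_ ?_ ?_ ?_
      · intro p q r s h; rwa [add_comm]
      · intro p q r s h; rwa [add_comm (x s)]
      · intro p q r s h; exact h.symm
      · intro p q r s hq hx
        exact h _ (mem_midVectors.2 (Or.inr ⟨p, q, r, s, hq, rfl⟩))
          (by rw [form_midVector, sub_sub, hx, sub_self])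
  · rintro ⟨hinj, hx⟩ c hc
    rcases mem_midVectors.1 hc with ⟨i, j, hij, rfl⟩ | ⟨p, q, r, s, hq, rfl⟩
    · rw [form_braidVector]
      exact sub_ne_zero.2 (hinj.ne hij.ne)
    · rw [form_midVector, sub_sub]
      exact sub_ne_zero.2 (hx p q r s hq.2.2.2)

theorem mem_complement_midArrangement {x : Fin m → ℝ} :
    x ∈ complement (midArrangement m) ↔
      Function.Injective x ∧ ∀ p q r s, [p, q, r, s].Nodup → x p + x q ≠ x r + x s := by
  classical
  rw [midArrangement_eq, ← forall_form_ne_zero_iff]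
  exact mem_complement_image_ker

end MidVectors

/-! ### Ranking patterns of sorted points and chambers -/

section SameOrder
variable {m : ℕ}

/-- The coordinates of `x` and `y`, and their midpoints, are ordered in the same way. -/
def SameOrder (x y : Fin m → ℝ) : Prop :=
  (∀ i j, x i < x j ↔ y i < y j) ∧
    ∀ p q r s, [p, q, r, s].Nodup → (x p + x q < x r + x s ↔ y p + y q < y r + y s)

theorem lt_iff_lt_of_ne {a b c d : ℝ} (hab : a ≠ b) (hcd : c ≠ d) (h : a < b ↔ c < d) :
    b < a ↔ d < c := by
  rw [lt_iff_le_and_ne, lt_iff_le_and_ne, ← not_lt, ← not_lt, h]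
  simp [hab.symm, hcd.symm]

theorem posSet_eq_iff_sameOrder {x y : Fin m → ℝ} (hx : x ∈ complement (midArrangement m))
    (hy : y ∈ complement (midArrangement m)) :
    posSet (midVectors m) (form ℝ) x = posSet (midVectors m) (form ℝ) y ↔ SameOrder x y := by
  rw [mem_complement_midArrangement] at hx hy
  rw [posSet_eq_iff]
  constructor
  · intro h
    constructor
    · have key : ∀ i j : Fin m, i < j → (x j < x i ↔ y j < y i) := by
        intro i j hij
        have := h _ (mem_midVectors.2 (Or.inl ⟨i, j, hij, rfl⟩))
        simpa only [form_braidVector, sub_pos] using this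
      intro i j
      rcases lt_trichotomy i j with hij | rfl | hij
      · exact lt_iff_lt_of_ne (hx.1.ne hij.ne') (hy.1.ne hij.ne') (key i j hij)
      · simp
      · exact key j i hij
    · have := forall_nodup_of_quadruples (m := m)
        (R := fun p q r s => [p, q, r, s].Nodup →
          (x p + x q < x r + x s ↔ y p + y q < y r + y s)) ?_ ?_ ?_ ?_
      · exact fun p q r s hn => this p q r s hn hn
      · intro p q r s h hn
        rw [add_comm (x q), add_comm (y q)]
        exact h (by simp at hn ⊢; tauto)
      · intro p q r s h hn
        rw [add_comm (x s), add_comm (y s)]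
        exact h (by simp at hn ⊢; tauto)
      · intro p q r s h hn
        have hn' : [p, q, r, s].Nodup := by simp at hn ⊢; tauto
        exact lt_iff_lt_of_ne (hx.2 _ _ _ _ hn') (hy.2 _ _ _ _ hn') (h hn')
      · intro p q r s hq hn
        have := h _ (mem_midVectors.2 (Or.inr ⟨p, q, r, s, hq, rfl⟩))
        simp only [form_midVector, sub_sub, sub_pos] at this
        exact lt_iff_lt_of_ne (hx.2 _ _ _ _ hn).symm (hy.2 _ _ _ _ hn).symm this
  · intro h c hc
    rcases mem_midVectors.1 hc with ⟨i, j, hij, rfl⟩ | ⟨p, q, r, s, hq, rfl⟩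
    · simpa only [form_braidVector, sub_pos] using h.1 j i
    · simp only [form_midVector, sub_sub, sub_pos]
      exact h.2 r s p q (by have := hq.2.2.2; simp at this ⊢; tauto)

/-- The definition compares only midpoints of disjoint pairs; for pairs with a common index the
comparison reduces to one of coordinates. -/
theorem SameOrder.add_lt_add {x y : Fin m → ℝ} (h : SameOrder x y) {i j k l : Fin m}
    (hij : i ≠ j) (hkl : k ≠ l) (hx : x i + x j < x k + x l) : y i + y j < y k + y l := by
  by_cases h1 : i = k
  · subst h1; have := (h.1 j l).1 (by linarith); linarith
  by_cases h2 : i = l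
  · subst h2; have := (h.1 j k).1 (by linarith); linarith
  by_cases h3 : j = k
  · subst h3; have := (h.1 i l).1 (by linarith); linarith
  by_cases h4 : j = l
  · subst h4; have := (h.1 i k).1 (by linarith); linarith
  exact (h.2 i j k l (by simp; tauto)).1 hx

theorem abs_sub_lt_abs_sub_iff {a b t : ℝ} (h : a < b) : |t - a| < |t - b| ↔ 2 * t < a + b := by
  rw [← sq_lt_sq]
  constructor
  · intro h'
    by_contra hcon
    nlinarith
  · intro h'
    nlinarith

theorem abs_sub_lt_abs_sub_iff' {a b t : ℝ} (h : a < b) :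
    |t - b| < |t - a| ↔ a + b < 2 * t := by
  rw [← sq_lt_sq]
  constructor
  · intro h'
    by_contra hcon
    nlinarith
  · intro h'
    nlinarith

theorem symm_lt_symm_iff {x : Fin m → ℝ} (hx : StrictMono x)
    (hxc : x ∈ complement (midArrangement m)) (t : nonMidpoints x) {i j : Fin m} (hij : i < j) :
    (rankingMap x t).symm i < (rankingMap x t).symm j ↔ 2 * (t : ℝ) < x i + x j := by
  rw [← abs_sub_lt_abs_sub_iff (hx hij), ← ((rankingMap_eq_iff x hxc t _).1 rfl).lt_iff_lt]
  simp

theorem exists_nonMidpoint_between (x : Fin m → ℝ) {a b : ℝ} (h : a < b) :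
    ∃ t ∈ nonMidpoints x, a < 2 * t ∧ 2 * t < b := by
  obtain ⟨t, ht, ht'⟩ := (Set.Ioo_infinite (show a / 2 < b / 2 by linarith)).exists_notMem_finset
    (Finset.univ.image fun a : Fin m × Fin m => (x a.1 + x a.2) / 2)
  refine ⟨t, fun i j _ h => ht' ?_, by linarith [ht.1], by linarith [ht.2]⟩
  exact Finset.mem_image.2 ⟨(i, j), Finset.mem_univ _, h.symm⟩

/-- The ranking at a point `t` between the two midpoints shows on which side of each midpoint `t`
lies. The same ranking occurs for `y` at some `u`, which therefore separates the corresponding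
midpoints of `y`. -/
theorem add_lt_add_of_rankingPattern_eq {x y : Fin m → ℝ} (hx : StrictMono x)
    (hxc : x ∈ complement (midArrangement m)) (hy : StrictMono y)
    (hyc : y ∈ complement (midArrangement m)) (h : rankingPattern x = rankingPattern y)
    (p q r s : Fin m) (hpq : p < q) (hrs : r < s) (hlt : x p + x q < x r + x s) :
    y p + y q < y r + y s := by
  obtain ⟨t, ht, h1, h2⟩ := exists_nonMidpoint_between x hlt
  have hmem : rankingMap x ⟨t, ht⟩ ∈ rankingPattern y := h ▸ ⟨_, rfl⟩
  obtain ⟨u, hu⟩ := hmem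
  have e1 := symm_lt_symm_iff hx hxc ⟨t, ht⟩ hpq
  have e2 := symm_lt_symm_iff hx hxc ⟨t, ht⟩ hrs
  rw [← hu, symm_lt_symm_iff hy hyc u hpq] at e1
  rw [← hu, symm_lt_symm_iff hy hyc u hrs] at e2
  have h3 := e1.not.2 h1.not_gt
  have h4 := e2.2 h2
  linarith

theorem SameOrder.symm {x y : Fin m → ℝ} (h : SameOrder x y) : SameOrder y x :=
  ⟨fun i j => (h.1 i j).symm, fun p q r s hn => (h.2 p q r s hn).symm⟩

theorem SameOrder.rankingPattern_subset {x y : Fin m → ℝ} (h : SameOrder x y)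
    (hx : StrictMono x) (hxc : x ∈ complement (midArrangement m)) (hy : StrictMono y)
    (hyc : y ∈ complement (midArrangement m)) : rankingPattern x ⊆ rankingPattern y := by
  rintro _ ⟨t, rfl⟩
  -- The point `u` must lie among the midpoints of `y` as `t` does among those of `x`. It exists
  -- because every midpoint that has to be below it is smaller than every one that has to be above.
  obtain ⟨u, hu1, hu2⟩ := Order.exists_between_finsets
    (((Finset.univ.filter fun a : Fin m × Fin m => a.1 < a.2 ∧ x a.1 + x a.2 < 2 * t).image
      fun a => (y a.1 + y a.2) / 2))
    (((Finset.univ.filter fun a : Fin m × Fin m => a.1 < a.2 ∧ 2 * t < x a.1 + x a.2).image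
      fun a => (y a.1 + y a.2) / 2)) (by
    simp only [Finset.mem_image, Finset.mem_filter, Finset.mem_univ, true_and]
    rintro _ ⟨a, ⟨ha, ha'⟩, rfl⟩ _ ⟨b, ⟨hb, hb'⟩, rfl⟩
    have := h.add_lt_add ha.ne hb.ne (ha'.trans hb')
    linarith)
  have lo : ∀ i j, i < j → x i + x j < 2 * t → y i + y j < 2 * u := by
    intro i j hij hlt
    have := hu1 _ (Finset.mem_image.2 ⟨(i, j), by simp [hij, hlt], rfl⟩)
    linarith
  have hi : ∀ i j, i < j → 2 * t < x i + x j → 2 * u < y i + y j := by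
    intro i j hij hlt
    have := hu2 _ (Finset.mem_image.2 ⟨(i, j), by simp [hij, hlt], rfl⟩)
    linarith
  have hne : ∀ i j, i < j → 2 * (t : ℝ) ≠ x i + x j := fun i j hij h =>
    t.2 i j hij (by linarith)
  have hu : u ∈ nonMidpoints y := by
    intro i j hij he
    rcases (hne i j hij).lt_or_gt with h | h
    · have := hi i j hij h; linarith
    · have := lo i j hij h; linarith
  refine ⟨⟨u, hu⟩, (rankingMap_eq_iff y hyc _ _).2 fun a b hab => ?_⟩
  have hxab := (rankingMap_eq_iff x hxc t _).1 rfl hab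
  simp only at hxab ⊢
  have hneq : rankingMap x t a ≠ rankingMap x t b := (Equiv.injective _).ne hab.ne
  generalize rankingMap x t a = i at *
  generalize rankingMap x t b = j at *
  rcases hneq.lt_or_gt with hij | hij
  · rw [abs_sub_lt_abs_sub_iff (hx hij)] at hxab
    exact (abs_sub_lt_abs_sub_iff (hy hij)).2 (hi i j hij hxab)
  · rw [abs_sub_lt_abs_sub_iff' (hx hij)] at hxab
    exact (abs_sub_lt_abs_sub_iff' (hy hij)).2 (lo j i hij hxab)

theorem rankingPattern_eq_iff_sameOrder {x y : Fin m → ℝ} (hx : StrictMono x)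
    (hxc : x ∈ complement (midArrangement m)) (hy : StrictMono y)
    (hyc : y ∈ complement (midArrangement m)) :
    rankingPattern x = rankingPattern y ↔ SameOrder x y := by
  constructor
  · intro h
    refine ⟨fun i j => by rw [hx.lt_iff_lt, hy.lt_iff_lt], fun p q r s hn => ?_⟩
    have key : ∀ p q r s : Fin m, p < q → r < s →
        (x p + x q < x r + x s ↔ y p + y q < y r + y s) := fun p q r s hpq hrs =>
      ⟨add_lt_add_of_rankingPattern_eq hx hxc hy hyc h p q r s hpq hrs,
        add_lt_add_of_rankingPattern_eq hy hyc hx hxc h.symm p q r s hpq hrs⟩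
    have hpq : p ≠ q := by simp at hn; tauto
    have hrs : r ≠ s := by simp at hn; tauto
    rcases hpq.lt_or_gt with hpq | hpq <;> rcases hrs.lt_or_gt with hrs | hrs
    · exact key p q r s hpq hrs
    · rw [add_comm (x r), add_comm (y r)]; exact key p q s r hpq hrs
    · rw [add_comm (x p), add_comm (y p)]; exact key q p r s hpq hrs
    · rw [add_comm (x r), add_comm (y r), add_comm (x p), add_comm (y p)]
      exact key q p s r hpq hrs
  · intro h
    exact (h.rankingPattern_subset hx hxc hy hyc).antisymm
      (h.symm.rankingPattern_subset hy hyc hx hxc)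

theorem comp_perm_mem_complement {x : Fin m → ℝ} (hx : x ∈ complement (midArrangement m))
    (σ : Equiv.Perm (Fin m)) : x ∘ σ ∈ complement (midArrangement m) := by
  rw [mem_complement_midArrangement] at hx ⊢
  refine ⟨hx.1.comp σ.injective, fun p q r s hn => hx.2 _ _ _ _ ?_⟩
  simpa using hn

theorem sameOrder_comp_iff {x y : Fin m → ℝ} (σ : Equiv.Perm (Fin m)) :
    SameOrder (x ∘ σ) (y ∘ σ) ↔ SameOrder x y := by
  have key : ∀ (x y : Fin m → ℝ) (σ : Equiv.Perm (Fin m)), SameOrder x y →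
      SameOrder (x ∘ σ) (y ∘ σ) := fun x y σ h =>
    ⟨fun i j => h.1 _ _, fun p q r s hn => h.2 _ _ _ _ (by simpa using hn)⟩
  refine ⟨fun h => ?_, key x y σ⟩
  have := key _ _ σ.symm h
  simpa [Function.comp_assoc] using this

theorem strictMono_comp_sort {x : Fin m → ℝ} (hx : Function.Injective x) :
    StrictMono (x ∘ Tuple.sort x) :=
  (Tuple.monotone_sort x).strictMono_of_injective (hx.comp (Equiv.injective _))

theorem sort_eq_of_strictMono {x : Fin m → ℝ} {σ : Equiv.Perm (Fin m)}
    (h : StrictMono (x ∘ σ)) : Tuple.sort x = σ := by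
  have hinj : Function.Injective x := by
    simpa using h.injective.comp σ.symm.injective
  have h2 := Tuple.unique_monotone (f := x) (Tuple.monotone_sort x) h.monotone
  ext k
  exact congrArg Fin.val (hinj (congrFun h2 k))

/-- Splits a chamber into a permutation and a chamber of sorted points, the source of the factor
`m!`. -/
theorem sameOrder_iff_sort {x y : Fin m → ℝ} (hx : Function.Injective x) :
    SameOrder x y ↔ Tuple.sort x = Tuple.sort y ∧
      SameOrder (x ∘ Tuple.sort x) (y ∘ Tuple.sort y) := by
  constructor
  · intro h
    have : Tuple.sort y = Tuple.sort x :=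
      sort_eq_of_strictMono fun a b hab => (h.1 _ _).1 (strictMono_comp_sort hx hab)
    rw [this]
    exact ⟨rfl, (sameOrder_comp_iff _).2 h⟩
  · rintro ⟨h1, h2⟩
    rw [h1] at h2
    exact (sameOrder_comp_iff _).1 h2

/-- Each ranking pattern of a sorted point corresponds to `m!` chambers. -/
theorem factorial_mul_numRankingPatterns (m : ℕ) :
    m.factorial * numRankingPatterns m = (chambers (midArrangement m)).ncard := by
  classical
  set S := {x : Fin m → ℝ | StrictMono x ∧ x ∈ complement (midArrangement m)} with hS
  set P := posSet (midVectors m) (form ℝ) with hP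
  have h1 : numRankingPatterns m = (P '' S).ncard :=
    ncard_image_eq_ncard_image fun x hx y hy => by
      rw [rankingPattern_eq_iff_sameOrder hx.1 hx.2 hy.1 hy.2,
        posSet_eq_iff_sameOrder hx.2 hy.2]
  have h2 : (chambers (midArrangement m)).ncard =
      (P '' complement (midArrangement m)).ncard := by
    rw [midArrangement_eq, chambers_ncard_eq, signVectors]
    congr 2
    ext x
    simp [mem_complement_image_ker]
  have h3 : (P '' complement (midArrangement m)).ncard =
      ((fun x => (Tuple.sort x, P (x ∘ Tuple.sort x))) ''
        complement (midArrangement m)).ncard := by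
    refine ncard_image_eq_ncard_image fun x hx y hy => ?_
    rw [Prod.mk.injEq, posSet_eq_iff_sameOrder hx hy,
      posSet_eq_iff_sameOrder (comp_perm_mem_complement hx _) (comp_perm_mem_complement hy _)]
    exact sameOrder_iff_sort (mem_complement_midArrangement.1 hx).1
  -- Every pair occurs: for sorted `x`, the point `x ∘ σ.symm` is sorted by `σ` and becomes `x`.
  have h4 : (fun x => (Tuple.sort x, P (x ∘ Tuple.sort x))) ''
      complement (midArrangement m) = Set.univ ×ˢ (P '' S) := by
    ext ⟨σ, s⟩
    constructor
    · rintro ⟨x, hx, h⟩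
      obtain ⟨rfl, rfl⟩ := Prod.mk.injEq .. ▸ h
      exact ⟨trivial, _, ⟨strictMono_comp_sort (mem_complement_midArrangement.1 hx).1,
        comp_perm_mem_complement hx _⟩, rfl⟩
    · rintro ⟨-, x, hx, rfl⟩
      have hxσ : (x ∘ σ.symm) ∘ σ = x := by simp [Function.comp_assoc]
      have hsort : Tuple.sort (x ∘ σ.symm) = σ :=
        sort_eq_of_strictMono (hxσ.symm ▸ hx.1)
      refine ⟨x ∘ σ.symm, comp_perm_mem_complement hx.2 _, ?_⟩
      simp only [hsort, hxσ]
  rw [h1, h2, h3, h4, Set.ncard_prod, Set.ncard_univ, Nat.card_perm, Nat.card_fin]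

end SameOrder

/-! ### Determinants of short vectors modulo a prime -/

section Determinants

/-- **Hadamard's inequality**. -/
theorem det_sq_le_prod_sum_sq {n : ℕ} (A : Matrix (Fin n) (Fin n) ℝ) :
    A.det ^ 2 ≤ ∏ i, ∑ j, A i j ^ 2 := by
  have hn : Fact (Module.finrank ℝ (EuclideanSpace ℝ (Fin n)) = n) := ⟨by simp⟩
  set b := EuclideanSpace.basisFun (Fin n) ℝ
  have h := b.toBasis.orientation.abs_volumeForm_apply_le fun i => WithLp.toLp 2 (A i)
  have hdet : b.toBasis.det (fun i => WithLp.toLp 2 (A i)) = A.det := by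
    rw [Module.Basis.det_apply, ← Matrix.det_transpose A]
    congr 1
  rw [Orientation.volumeForm_robust' _ b, hdet] at h
  have h2 := pow_le_pow_left₀ (abs_nonneg _) h 2
  rw [sq_abs, ← Finset.prod_pow] at h2
  refine h2.trans_eq (Finset.prod_congr rfl fun i _ => ?_)
  rw [EuclideanSpace.norm_sq_eq]
  simp

theorem det_sq_le_prod_sum_sq_int {n : ℕ} (A : Matrix (Fin n) (Fin n) ℤ) :
    A.det ^ 2 ≤ ∏ i, ∑ j, A i j ^ 2 := by
  have h := det_sq_le_prod_sum_sq (A.map ((↑) : ℤ → ℝ))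
  have hd : (A.map ((↑) : ℤ → ℝ)).det = (A.det : ℝ) :=
    ((Int.castRingHom ℝ).map_det A).symm
  rw [hd] at h
  simp only [Matrix.map_apply] at h
  exact_mod_cast h

/-- The integer vectors with coordinate sum `0` and Euclidean norm at most `2`. -/
def shortVectors (m : ℕ) : Set (Fin m → ℤ) :=
  {c | ∑ i, c i = 0 ∧ ∑ i, c i ^ 2 ≤ 4}

variable {m : ℕ}

/-- All rows but row `k` have sum `0`, so `A` maps the vector of ones to `m e_k`; applying the
adjugate gives `det A` times the vector of ones as a multiple of `m`. -/
theorem natCast_dvd_det {A : Matrix (Fin m) (Fin m) ℤ} {k : Fin m} (hk : A k = 1)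
    (hA : ∀ i ≠ k, A i ∈ shortVectors m) : (m : ℤ) ∣ A.det := by
  have h1 : A.mulVec 1 = (m : ℤ) • Pi.single k 1 := by
    ext i
    simp only [Matrix.mulVec, dotProduct, Pi.one_apply, mul_one, Pi.smul_apply, smul_eq_mul]
    by_cases hi : i = k
    · subst hi; simp [hk]
    · simp [hi, (hA i hi).1]
  have h2 : A.adjugate.mulVec (A.mulVec 1) = A.det • (1 : Fin m → ℤ) := by
    rw [Matrix.mulVec_mulVec, Matrix.adjugate_mul, Matrix.smul_mulVec, Matrix.one_mulVec]
  have h3 := congrFun h2 k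
  rw [h1, Matrix.mulVec_smul] at h3
  simp only [Pi.smul_apply, smul_eq_mul, Pi.one_apply, mul_one] at h3
  exact ⟨_, h3.symm⟩

theorem det_sq_le {A : Matrix (Fin m) (Fin m) ℤ} {k : Fin m} (hk : A k = 1)
    (hA : ∀ i ≠ k, A i ∈ shortVectors m) : A.det ^ 2 ≤ 4 ^ (m - 1) * m := by
  refine (det_sq_le_prod_sum_sq_int A).trans ?_
  rw [← Finset.prod_erase_mul _ _ (Finset.mem_univ k)]
  have h1 : ∑ j, A k j ^ 2 = m := by simp [hk]
  rw [h1]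
  refine mul_le_mul_of_nonneg_right ?_ (Nat.cast_nonneg m)
  calc ∏ i ∈ Finset.univ.erase k, ∑ j, A i j ^ 2
      ≤ ∏ i ∈ Finset.univ.erase k, (4 : ℤ) :=
        Finset.prod_le_prod (fun i _ => Finset.sum_nonneg fun j _ => sq_nonneg _)
          fun i hi => (hA i (Finset.ne_of_mem_erase hi)).2
    _ = 4 ^ (m - 1) := by simp

/-- If `q` divided a nonzero determinant, so would `m q`, whence `(m q)² ≤ det² ≤ 4^(m-1) m`.
Without the divisor `m` the condition would be `4^(m-1) m < q²`, forcing far larger primes on the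
computation. -/
theorem det_cast_ne_zero {q : ℕ} [hq : Fact q.Prime] (hqm : ¬ q ∣ m)
    (hbound : 4 ^ (m - 1) < m * q ^ 2) {A : Matrix (Fin m) (Fin m) ℤ} {k : Fin m}
    (hk : A k = 1) (hA : ∀ i ≠ k, A i ∈ shortVectors m) (h0 : A.det ≠ 0) :
    (A.det : ZMod q) ≠ 0 := by
  intro h
  rw [ZMod.intCast_zmod_eq_zero_iff_dvd] at h
  have hcop : IsCoprime (m : ℤ) (q : ℤ) :=
    Nat.isCoprime_iff_coprime.2 ((Nat.Prime.coprime_iff_not_dvd hq.out).2 hqm).symm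
  obtain ⟨d, hd⟩ := hcop.mul_dvd (natCast_dvd_det hk hA) h
  have hd0 : d ≠ 0 := by rintro rfl; exact h0 (by rw [hd, mul_zero])
  have h1 : 1 ≤ d ^ 2 := Int.one_le_abs hd0 |> fun h => by nlinarith [sq_abs d]
  have h2 := det_sq_le hk hA
  have hm : 0 < (m : ℤ) := by exact_mod_cast k.pos
  have hb : (4 : ℤ) ^ (m - 1) < m * q ^ 2 := by exact_mod_cast hbound
  rw [hd] at h2
  have h3 : ((m : ℤ) * q) ^ 2 ≤ (m * q * d) ^ 2 := by
    rw [mul_pow _ d]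
    exact le_mul_of_one_le_right (sq_nonneg _) h1
  have h4 : (4 : ℤ) ^ (m - 1) * m < m * q ^ 2 * m := mul_lt_mul_of_pos_right hb hm
  nlinarith

end Determinants

/-! ### Equality of ranks over the reals and over a prime field -/

section Rank
variable {m : ℕ} (K : Type*) [Field K]

/-- The image in `K^m` of an integer vector. -/
def castVector (c : Fin m → ℤ) : Fin m → K := fun i => (c i : K)

variable {K}

theorem braidVector_mem_shortVectors (i j : Fin m) : braidVector i j ∈ shortVectors m := by
  have h1 : ∑ k, braidVector i j k = 0 := by
    simp [braidVector]
  have h2 : ∑ k, braidVector i j k ^ 2 = braidVector i j i - braidVector i j j := by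
    simpa [form_apply, sq] using form_braidVector (K := ℤ) i j (braidVector i j)
  refine ⟨h1, ?_⟩
  rw [h2]
  by_cases hij : i = j
  · simp [hij]
  · simp [braidVector, hij, Ne.symm hij]

theorem midVector_mem_shortVectors {p q r s : Fin m} (hn : [p, q, r, s].Nodup) :
    midVector p q r s ∈ shortVectors m := by
  have h1 : ∑ k, midVector p q r s k = 0 := by
    simp [midVector, Finset.sum_add_distrib]
  have h2 : ∑ k, midVector p q r s k ^ 2 = midVector p q r s p + midVector p q r s q -
      midVector p q r s r - midVector p q r s s := by
    simpa [form_apply, sq] using form_midVector (K := ℤ) p q r s (midVector p q r s)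
  refine ⟨h1, ?_⟩
  rw [h2]
  simp only [List.nodup_cons, List.mem_cons, List.not_mem_nil, or_false, not_or] at hn
  obtain ⟨⟨a1, a2, a3⟩, ⟨a4, a5⟩, a6, -⟩ := hn
  simp [midVector, a1, a2, a3, a4, a5, a6, Ne.symm a1, Ne.symm a2, Ne.symm a3, Ne.symm a4,
    Ne.symm a5, Ne.symm a6]

theorem midVectors_subset_shortVectors : ↑(midVectors m) ⊆ shortVectors m := by
  intro c hc
  rcases mem_midVectors.1 hc with ⟨i, j, -, rfl⟩ | ⟨p, q, r, s, hq, rfl⟩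
  · exact braidVector_mem_shortVectors i j
  · exact midVector_mem_shortVectors hq.2.2.2

theorem castVector_one_notMem_span (hm : (m : K) ≠ 0) {s : Set (Fin m → ℤ)}
    (hs : s ⊆ shortVectors m) : castVector K 1 ∉ Submodule.span K (castVector K '' s) := by
  have hle : Submodule.span K (castVector K '' s) ≤
      LinearMap.ker (∑ i, LinearMap.proj i : (Fin m → K) →ₗ[K] K) := by
    rw [Submodule.span_le]
    rintro _ ⟨c, hc, rfl⟩
    have := (hs hc).1
    simp only [SetLike.mem_coe, LinearMap.mem_ker, LinearMap.sum_apply, LinearMap.proj_apply,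
      castVector]
    exact_mod_cast congrArg (Int.cast (R := K)) this
  intro h
  have := hle h
  simp [castVector] at this
  exact hm this

/-- Subtracting all `e_i - e_j` from the vector of ones leaves `m e_j`. -/
theorem span_castVector_eq_top (hm : (m : K) ≠ 0) :
    Submodule.span K (castVector K '' insert 1 (shortVectors m)) = ⊤ := by
  set W := Submodule.span K (castVector K '' insert 1 (shortVectors m)) with hW
  have h1 : castVector K 1 ∈ W :=
    Submodule.subset_span ⟨1, Set.mem_insert _ _, rfl⟩
  have h2 : ∀ i j : Fin m, castVector K (braidVector i j) ∈ W := fun i j =>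
    Submodule.subset_span ⟨_, Set.mem_insert_of_mem _ (braidVector_mem_shortVectors i j), rfl⟩
  have h3 : ∀ j : Fin m, Pi.single j (1 : K) ∈ W := by
    intro j
    have h4 : (m : K) • Pi.single j (1 : K) =
        castVector K 1 - ∑ i : Fin m, castVector K (braidVector i j) := by
      ext k
      simp only [Pi.smul_apply, smul_eq_mul, Pi.sub_apply, castVector, Finset.sum_apply,
        braidVector, Pi.one_apply, Int.cast_one, Int.cast_sub, Finset.sum_sub_distrib,
        Finset.sum_const, Finset.card_univ, Fintype.card_fin, nsmul_eq_mul]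
      rw [Finset.sum_eq_single k (fun b _ hb => by simp [Ne.symm hb])
        (by simp)]
      by_cases hk : k = j
      · subst hk; simp
      · simp [hk]
    have h5 : (m : K) • Pi.single j (1 : K) ∈ W :=
      h4 ▸ W.sub_mem h1 (W.sum_mem fun i _ => h2 i j)
    exact (W.smul_mem_iff hm).1 h5
  rw [eq_top_iff, ← (Pi.basisFun K (Fin m)).span_eq, Submodule.span_le]
  rintro _ ⟨j, rfl⟩
  simpa using h3 j

/-- A set of short vectors that is independent over `K` consists of rows of a square matrix with
nonzero determinant whose other rows are short vectors and the vector `1`. -/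
theorem exists_matrix_of_linearIndepOn (hm : (m : K) ≠ 0) {s : Set (Fin m → ℤ)}
    (hs : s ⊆ shortVectors m) (hli : LinearIndepOn K (castVector K) s) :
    ∃ (A : Matrix (Fin m) (Fin m) ℤ) (k : Fin m), A k = 1 ∧
      (∀ i ≠ k, A i ∈ shortVectors m) ∧ s ⊆ Set.range A ∧ (A.det : K) ≠ 0 := by
  -- The independent set is enlarged to a basis inside the spanning set of `1` and the short
  -- vectors, so that the determinant bounds apply to its matrix.
  obtain ⟨b, hbt, hsb, hspan, hb⟩ := exists_linearIndepOn_extension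
    (hli.insert (castVector_one_notMem_span hm hs)) (Set.insert_subset_insert (a := 1) hs)
  have htop : ⊤ ≤ Submodule.span K (Set.range fun c : b => castVector K (c : Fin m → ℤ)) := by
    rw [← span_castVector_eq_top hm, Submodule.span_le, ← Set.image_eq_range]
    exact hspan
  let e := (Module.Basis.mk hb htop).indexEquiv (Pi.basisFun K (Fin m))
  let A : Matrix (Fin m) (Fin m) ℤ := fun i => (e.symm i : Fin m → ℤ)
  have hA1 : (1 : Fin m → ℤ) ∈ b := hsb (Set.mem_insert _ _)
  refine ⟨A, e ⟨1, hA1⟩, by simp [A], fun i hi => ?_, fun c hc => ?_, ?_⟩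
  · refine (hbt (e.symm i).2).resolve_left fun h => hi ?_
    rw [← e.apply_symm_apply i]
    exact congrArg e (Subtype.ext h)
  · exact ⟨e ⟨c, hsb (Set.mem_insert_of_mem _ hc)⟩, by simp [A]⟩
  · have hrow : LinearIndependent K (A.map (Int.castRingHom K)).row := by
      have := LinearIndependent.comp hb e.symm e.symm.injective
      exact this
    rw [Matrix.linearIndependent_rows_iff_isUnit, Matrix.isUnit_iff_isUnit_det] at hrow
    have hd : (A.map (Int.castRingHom K)).det = (A.det : K) :=
      ((Int.castRingHom K).map_det A).symm
    rw [← hd]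
    exact hrow.ne_zero

theorem linearIndepOn_range_of_det_ne_zero {A : Matrix (Fin m) (Fin m) ℤ}
    (hA : (A.det : K) ≠ 0) : LinearIndepOn K (castVector K) (Set.range A) := by
  have hrow : LinearIndependent K (A.map (Int.castRingHom K)).row := by
    have hd : (A.map (Int.castRingHom K)).det = (A.det : K) :=
      ((Int.castRingHom K).map_det A).symm
    rw [Matrix.linearIndependent_rows_iff_isUnit, Matrix.isUnit_iff_isUnit_det, hd]
    exact hA.isUnit
  have hcomp : LinearIndependent K (castVector K ∘ A) := hrow
  exact (linearIndepOn_range_iff hcomp.injective.of_comp _).2 hcomp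

/-- A maximal subset of `B` independent over `K` sits among the rows of a matrix with determinant
nonzero in `K`, hence in `L`, so it stays independent over `L`. From `ℝ` to `ZMod q` this uses the
determinant bound; the other direction is immediate. -/
theorem finrank_span_le {L : Type*} [Field L] (hm : (m : K) ≠ 0)
    (hKL : ∀ (A : Matrix (Fin m) (Fin m) ℤ) (k : Fin m), A k = 1 →
      (∀ i ≠ k, A i ∈ shortVectors m) → (A.det : K) ≠ 0 → (A.det : L) ≠ 0)
    {B : Set (Fin m → ℤ)} (hB : B ⊆ shortVectors m) :
    Module.finrank K (Submodule.span K (castVector K '' B)) ≤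
      Module.finrank L (Submodule.span L (castVector L '' B)) := by
  obtain ⟨b, hbB, -, hspan, hb⟩ := exists_linearIndepOn_extension
    (linearIndepOn_empty K (castVector K)) (Set.empty_subset B)
  obtain ⟨A, k, hk, hA, hbA, hdet⟩ := exists_matrix_of_linearIndepOn hm (hbB.trans hB) hb
  have hb' : LinearIndepOn L (castVector L) b :=
    (linearIndepOn_range_of_det_ne_zero (hKL A k hk hA hdet)).mono hbA
  have : Fintype b := ((Set.finite_range A).subset hbA).fintype
  have h1 : Submodule.span K (castVector K '' B) = Submodule.span K (castVector K '' b) :=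
    (Submodule.span_le.2 hspan).antisymm (Submodule.span_mono (Set.image_mono hbB))
  calc Module.finrank K (Submodule.span K (castVector K '' B))
      = Fintype.card b := by
        rw [h1, Set.image_eq_range]; exact finrank_span_eq_card hb
    _ = Module.finrank L (Submodule.span L (castVector L '' b)) := by
        rw [Set.image_eq_range]; exact (finrank_span_eq_card hb').symm
    _ ≤ _ := Submodule.finrank_mono (Submodule.span_mono (Set.image_mono hbB))

theorem finrank_inf_ker_add_finrank_span (B : Finset (Fin m → ℤ)) :
    Module.finrank K ↥(B.inf fun c => LinearMap.ker (form K c)) +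
      Module.finrank K (Submodule.span K (castVector K '' (B : Set (Fin m → ℤ)))) = m := by
  let A : Matrix B (Fin m) K := fun c => castVector K c
  have hker : LinearMap.ker A.mulVecLin = B.inf fun c => LinearMap.ker (form K c) := by
    ext x
    simp only [LinearMap.mem_ker, Matrix.mulVecLin_apply, Submodule.mem_finsetInf, form_apply]
    rw [funext_iff]
    exact ⟨fun h c hc => h ⟨c, hc⟩, fun h c => h c c.2⟩
  have h := A.mulVecLin.finrank_range_add_finrank_ker
  have hrk : Module.finrank K (LinearMap.range A.mulVecLin) = _ := A.rank_eq_finrank_span_row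
  have hrow : Set.range A.row = castVector K '' (B : Set (Fin m → ℤ)) := by
    rw [Set.image_eq_range]; rfl
  rw [hrk, hker, hrow, Module.finrank_fin_fun] at h
  omega

theorem finrank_inf_ker_eq {q : ℕ} [hq : Fact q.Prime] (hm : 0 < m) (hqm : ¬ q ∣ m)
    (hbound : 4 ^ (m - 1) < m * q ^ 2) {B : Finset (Fin m → ℤ)}
    (hB : ↑B ⊆ shortVectors m) :
    Module.finrank ℝ ↥(B.inf fun c => LinearMap.ker (form ℝ c)) =
      Module.finrank (ZMod q) ↥(B.inf fun c => LinearMap.ker (form (ZMod q) c)) := by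
  have h1 := finrank_inf_ker_add_finrank_span (K := ℝ) B
  have h2 := finrank_inf_ker_add_finrank_span (K := ZMod q) B
  have h3 := finrank_span_le (K := ℝ) (L := ZMod q) (by exact_mod_cast hm.ne')
    (fun A k hk hA h => det_cast_ne_zero hqm hbound hk hA (by exact_mod_cast h)) hB
  have h4 := finrank_span_le (K := ZMod q) (L := ℝ)
    (fun h => hqm ((ZMod.natCast_eq_zero_iff _ _).1 h))
    (fun A k hk hA h h0 => h (by rw [show A.det = 0 by exact_mod_cast h0, Int.cast_zero])) hB
  omega

end Rank

/-! ### The finite field method and interpolation -/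

section FiniteField
variable {m : ℕ}

/-- Inclusion-exclusion over the hyperplanes; the shape is that of Whitney's formula at `t = |K|`.
-/
theorem card_forall_form_ne_zero {K : Type*} [Field K] [Fintype K] [DecidableEq K]
    (I : Finset (Fin m → ℤ)) :
    ((Finset.univ.filter fun x : Fin m → K => ∀ c ∈ I, form K c x ≠ 0).card : ℤ) =
      ∑ B ∈ I.powerset, (-1) ^ B.card * (Fintype.card K : ℤ) ^
        Module.finrank K ↥(B.inf fun c => LinearMap.ker (form K c)) := by
  classical
  let S : (Fin m → ℤ) → Finset (Fin m → K) := fun c => Finset.univ.filter fun x => form K c x = 0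
  have h1 : (Finset.univ.filter fun x : Fin m → K => ∀ c ∈ I, form K c x ≠ 0) =
      I.inf fun c => (S c)ᶜ := by
    ext x
    simp [S, Finset.mem_inf]
  rw [h1, Finset.inclusion_exclusion_card_inf_compl]
  refine Finset.sum_congr rfl fun B _ => ?_
  congr 1
  rw [← Nat.cast_pow, ← Module.card_eq_pow_finrank]
  congr 1
  rw [Fintype.card_subtype]
  congr 1
  ext x
  simp [S, Finset.mem_inf, Submodule.mem_finsetInf]

theorem form_ne_zero_of_mem_midVectors {K : Type*} [Field K] {c : Fin m → ℤ}
    (hc : c ∈ midVectors m) : form K c ≠ 0 := by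
  rcases mem_midVectors.1 hc with ⟨i, j, hij, rfl⟩ | ⟨p, q, r, s, hq, rfl⟩
  · intro h
    have := LinearMap.congr_fun h (Pi.single i 1)
    rw [form_braidVector] at this
    simp [hij.ne'] at this
  · intro h
    have := LinearMap.congr_fun h (Pi.single p 1)
    rw [form_midVector] at this
    have hn := hq.2.2.2
    simp only [List.nodup_cons, List.mem_cons, List.not_mem_nil, or_false, not_or] at hn
    simp [Ne.symm hn.1.1, Ne.symm hn.1.2.1, Ne.symm hn.1.2.2] at this

theorem charPoly_midArrangement (m : ℕ) :
    charPoly (midArrangement m) = ∑ B ∈ (midVectors m).powerset,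
      Polynomial.C ((-1 : ℤ) ^ B.card) *
        Polynomial.X ^ Module.finrank ℝ ↥(B.inf fun c => LinearMap.ker (form ℝ c)) := by
  classical
  rw [midArrangement_eq]
  exact charPoly_image_eq_sum _ _ fun c hc h =>
    form_ne_zero_of_mem_midVectors hc (LinearMap.ker_eq_top.1 h)

/-- The **finite field method** for the mid-hyperplane arrangement. -/
theorem eval_charPoly_midArrangement {q : ℕ} [hq : Fact q.Prime] (hm : 0 < m) (hqm : ¬ q ∣ m)
    (hbound : 4 ^ (m - 1) < m * q ^ 2) :
    (charPoly (midArrangement m)).eval (q : ℤ) =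
      (Finset.univ.filter fun x : Fin m → ZMod q =>
        ∀ c ∈ midVectors m, form (ZMod q) c x ≠ 0).card := by
  rw [card_forall_form_ne_zero, charPoly_midArrangement, Polynomial.eval_finsetSum]
  refine Finset.sum_congr rfl fun B hB => ?_
  rw [finrank_inf_ker_eq hm hqm hbound ((Finset.coe_subset.2 (Finset.mem_powerset.1 hB)).trans
    midVectors_subset_shortVectors)]
  simp

/-- The vector of ones lies in every hyperplane, so no intersection has dimension `0`. -/
theorem eval_zero_charPoly_midArrangement (hm : 0 < m) :
    (charPoly (midArrangement m)).eval 0 = 0 := by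
  rw [charPoly_midArrangement, Polynomial.eval_finsetSum]
  refine Finset.sum_eq_zero fun B hB => ?_
  have hmem : (1 : Fin m → ℝ) ∈ B.inf fun c => LinearMap.ker (form ℝ c) := by
    rw [Submodule.mem_finsetInf]
    intro c hc
    have := (midVectors_subset_shortVectors (Finset.mem_powerset.1 hB hc)).1
    simp only [LinearMap.mem_ker, form_apply, Pi.one_apply, mul_one]
    exact_mod_cast this
  have hpos : Module.finrank ℝ ↥(B.inf fun c => LinearMap.ker (form ℝ c)) ≠ 0 := by
    intro h
    have h2 := Submodule.finrank_eq_zero.1 h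
    rw [h2, Submodule.mem_bot] at hmem
    exact one_ne_zero (congrFun hmem ⟨0, hm⟩)
  simp [hpos]

theorem eval_one_charPoly_midArrangement (hm : 2 ≤ m) :
    (charPoly (midArrangement m)).eval 1 = 0 := by
  classical
  have hne : midVectors m ≠ ∅ := Finset.ne_empty_of_mem (mem_midVectors.2
    (Or.inl ⟨⟨0, by omega⟩, ⟨1, by omega⟩, by simp, rfl⟩))
  rw [charPoly_midArrangement, Polynomial.eval_finsetSum]
  simpa [hne] using sum_neg_one_pow_card_eq_ite (midVectors m)

theorem degree_charPoly_midArrangement_sub_lt (m : ℕ) :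
    (charPoly (midArrangement m) - Polynomial.X ^ m).degree < (m : WithBot ℕ) := by
  classical
  have h0 : Polynomial.C ((-1 : ℤ) ^ (∅ : Finset (Fin m → ℤ)).card) * Polynomial.X ^
      Module.finrank ℝ ↥((∅ : Finset (Fin m → ℤ)).inf fun c => LinearMap.ker (form ℝ c)) =
      Polynomial.X ^ m := by
    rw [Finset.inf_empty, finrank_top, Module.finrank_fin_fun]
    simp
  rw [charPoly_midArrangement, ← Finset.add_sum_erase _ _ (Finset.empty_mem_powerset _), h0,
    add_sub_cancel_left]
  refine (Polynomial.degree_sum_le _ _).trans_lt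
    ((Finset.sup_lt_iff (WithBot.bot_lt_coe m)).2 fun B hB => ?_)
  obtain ⟨hB0, hB⟩ := Finset.mem_erase.1 hB
  obtain ⟨c, hc⟩ := Finset.nonempty_iff_ne_empty.2 hB0
  refine (Polynomial.degree_C_mul_X_pow_le _ _).trans_lt (Nat.cast_lt.2 ?_)
  have hlt : (B.inf fun c => LinearMap.ker (form ℝ c)) < ⊤ := by
    refine (Finset.inf_le hc).trans_lt (lt_top_iff_ne_top.2 fun h => ?_)
    exact form_ne_zero_of_mem_midVectors (Finset.mem_powerset.1 hB hc)
      (LinearMap.ker_eq_top.1 h)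
  simpa using Submodule.finrank_lt hlt.ne

/-- A monic polynomial of degree `m` that agrees with the characteristic polynomial at `m`
points is the characteristic polynomial. -/
theorem charPoly_midArrangement_eq_of_eval {P : ℤ[X]} (hP : P.Monic) (hdeg : P.natDegree = m)
    {s : Finset ℤ} (hs : s.card = m)
    (h : ∀ a ∈ s, (charPoly (midArrangement m)).eval a = P.eval a) :
    charPoly (midArrangement m) = P := by
  refine Polynomial.eq_of_degree_sub_lt_of_eval_finset_eq s ?_ h
  rw [hs, ← sub_sub_sub_cancel_right _ _ (Polynomial.X ^ m)]
  refine (Polynomial.degree_sub_le _ _).trans_lt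
    (max_lt (degree_charPoly_midArrangement_sub_lt m) ?_)
  have h1 : P.degree = m := by rw [Polynomial.degree_eq_natDegree hP.ne_zero, hdeg]
  refine h1 ▸ Polynomial.degree_sub_lt_left ?_ hP.ne_zero ?_
  · rw [h1, Polynomial.degree_X_pow]
  · rw [hP.leadingCoeff, (Polynomial.monic_X_pow m).leadingCoeff]

end FiniteField

/-! ### Weak Sidon sets and their extensions -/

section WeakSidon
variable {F : Type*}

/-- A set such that the sums of any two disjoint pairs of its elements differ. -/
def WeakSidon [Add F] (S : Finset F) : Prop :=
  ∀ a ∈ S, ∀ b ∈ S, ∀ c ∈ S, ∀ d ∈ S, [a, b, c, d].Nodup → a + b ≠ c + d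

theorem WeakSidon.mono [Add F] {S T : Finset F} (hT : WeakSidon T) (h : S ⊆ T) : WeakSidon S :=
  fun a ha b hb c hc d hd => hT a (h ha) b (h hb) c (h hc) d (h hd)

/-- A new bad equation must involve both `x` and `y`: on opposite sides it makes `y - x` a
difference of `S`, on the same side it makes `y + x` a sum. Hence the search needs only the
differences and sums of `S`. -/
theorem weakSidon_insert_insert [AddCommGroup F] [DecidableEq F] {S : Finset F} {x y : F}
    (hx : x ∉ S) (hy : y ∉ S) (hxy : x ≠ y) (hSx : WeakSidon (insert x S))
    (hSy : WeakSidon (insert y S)) :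
    WeakSidon (insert y (insert x S)) ↔
      (¬ ∃ a ∈ S, ∃ b ∈ S, a ≠ b ∧ y - x = a - b) ∧
        ¬ ∃ a ∈ S, ∃ b ∈ S, a ≠ b ∧ y + x = a + b := by
  have hmem : ∀ a ∈ S, a ≠ x ∧ a ≠ y := fun a ha =>
    ⟨fun h => hx (h ▸ ha), fun h => hy (h ▸ ha)⟩
  constructor
  · intro h
    constructor
    · rintro ⟨a, ha, b, hb, hab, he⟩
      refine h y (by simp) b (by simp [hb]) x (by simp) a (by simp [ha]) ?_ ?_
      · have h1 := hmem a ha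
        have h2 := hmem b hb
        simp [h1.1.symm, h2.2.symm, hxy.symm, h1.2.symm, h2.1, hab.symm]
      · rw [sub_eq_sub_iff_add_eq_add] at he
        rw [he, add_comm]
    · rintro ⟨a, ha, b, hb, hab, he⟩
      refine h y (by simp) x (by simp) a (by simp [ha]) b (by simp [hb]) ?_ he
      have h1 := hmem a ha
      have h2 := hmem b hb
      simp [h1.1.symm, h2.2.symm, hxy.symm, h1.2.symm, h2.1.symm, hab]
  · rintro ⟨hd, hs⟩ a ha b hb c hc d hd' hn he
    have hdiff : ∀ u ∈ S, ∀ v ∈ S, u ≠ v → y + v ≠ x + u := fun u hu v hv huv h =>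
      hd ⟨u, hu, v, hv, huv, by rw [sub_eq_sub_iff_add_eq_add, h, add_comm]⟩
    have hsum : ∀ u ∈ S, ∀ v ∈ S, u ≠ v → y + x ≠ u + v := fun u hu v hv huv h =>
      hs ⟨u, hu, v, hv, huv, h⟩
    obtain ⟨⟨n1, n2, n3⟩, ⟨n4, n5⟩, n6⟩ :
        (a ≠ b ∧ a ≠ c ∧ a ≠ d) ∧ (b ≠ c ∧ b ≠ d) ∧ c ≠ d := by
      simpa using hn
    have split : ∀ u ∈ insert y (insert x S), u = y ∨ u = x ∨ u ∈ S := by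
      intro u hu; simpa using hu
    by_cases hX : x ≠ a ∧ x ≠ b ∧ x ≠ c ∧ x ≠ d
    · have key : ∀ u ∈ insert y (insert x S), x ≠ u → u ∈ insert y S := by
        intro u hu hne
        rcases split u hu with h | h | h
        · simp [h]
        · exact absurd h.symm hne
        · simp [h]
      exact hSy a (key a ha hX.1) b (key b hb hX.2.1) c (key c hc hX.2.2.1) d
        (key d hd' hX.2.2.2) hn he
    by_cases hY : y ≠ a ∧ y ≠ b ∧ y ≠ c ∧ y ≠ d
    · have key : ∀ u ∈ insert y (insert x S), y ≠ u → u ∈ insert x S := by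
        intro u hu hne
        rcases split u hu with h | h | h
        · exact absurd h.symm hne
        · simp [h]
        · simp [h]
      exact hSx a (key a ha hY.1) b (key b hb hY.2.1) c (key c hc hY.2.2.1) d
        (key d hd' hY.2.2.2) hn he
    have key : ∀ u ∈ insert y (insert x S), y ≠ u → x ≠ u → u ∈ S := by
      intro u hu h1 h2
      rcases split u hu with h | h | h
      · exact absurd h.symm h1
      · exact absurd h.symm h2
      · exact h
    clear hSx hSy hd hs hmem split
    simp only [not_and_or, ne_eq, not_not] at hX hY
    -- The sixteen positions of `x` and `y` in the equation: four coincide, four are on the same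
    -- side, eight on opposite sides.
    rcases hX with rfl | rfl | rfl | rfl <;> rcases hY with rfl | rfl | rfl | rfl
    · exact hxy rfl
    · exact hsum c (key c hc n4 n2) d (key d hd' n5 n3) n6 (by rw [← he, add_comm])
    · exact hdiff b (key b hb n4.symm n1) d (key d hd' n6 n3) n5 he.symm
    · exact hdiff b (key b hb n5.symm n1) c (key c hc n6.symm n2) n4 (by rw [he, add_comm])
    · exact hsum c (key c hc n2 n4) d (key d hd' n3 n5) n6 he
    · exact hxy rfl
    · exact hdiff a (key a ha n2.symm n1.symm) d (key d hd' n6 n5) n3 (by rw [← he, add_comm])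
    · exact hdiff a (key a ha n3.symm n1.symm) c (key c hc n6.symm n4) n2
        (by rw [add_comm, ← he, add_comm])
    · exact hdiff d (key d hd' n3 n6) b (key b hb n1 n4.symm) n5.symm he
    · exact hdiff d (key d hd' n5 n6) a (key a ha n1.symm n2.symm) n3.symm
        (by rw [← he, add_comm])
    · exact hxy rfl
    · exact hsum a (key a ha n3.symm n2.symm) b (key b hb n5.symm n4.symm) n1
        (by rw [he, add_comm])
    · exact hdiff c (key c hc n2 n6.symm) b (key b hb n1 n5.symm) n4.symm
        (by rw [he, add_comm])
    · exact hdiff c (key c hc n4 n6.symm) a (key a ha n1.symm n3.symm) n2.symm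
        (by rw [add_comm, he, add_comm])
    · exact hsum a (key a ha n2.symm n3.symm) b (key b hb n4.symm n5.symm) n1 (he.symm)
    · exact hxy rfl

open Classical in
/-- The weak Sidon sets `S ∪ T` where `T` is a `k`-element subset of `C`, given by `T`. -/
noncomputable def extensions [Add F] [DecidableEq F] (k : ℕ) (C S : Finset F) : Finset (Finset F) :=
  (C.powersetCard k).filter fun T => WeakSidon (S ∪ T)

theorem card_extensions_zero [Add F] [DecidableEq F] {C S : Finset F} (hS : WeakSidon S) :
    (extensions 0 C S).card = 1 := by
  classical
  have : extensions 0 C S = {∅} := by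
    rw [extensions, Finset.powersetCard_zero]
    refine Finset.filter_true_of_mem fun T hT => ?_
    rw [Finset.mem_singleton.1 hT, Finset.union_empty]
    exact hS
  rw [this, Finset.card_singleton]

/-- Candidates are kept admissible one by one, so the last level of the search merely counts them.
-/
theorem card_extensions_one [Add F] [DecidableEq F] {C S : Finset F}
    (hC : ∀ y ∈ C, WeakSidon (insert y S)) : (extensions 1 C S).card = C.card := by
  classical
  have : extensions 1 C S = C.powersetCard 1 := by
    refine Finset.filter_true_of_mem fun T hT => ?_
    obtain ⟨hTC, hT1⟩ := Finset.mem_powersetCard.1 hT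
    obtain ⟨y, rfl⟩ := Finset.card_eq_one.1 hT1
    convert hC y (hTC (Finset.mem_singleton_self y)) using 1
    ext z
    simp
  rw [this, Finset.card_powersetCard, Nat.choose_one_right]

theorem card_extensions_empty [Add F] [DecidableEq F] (k : ℕ) (S : Finset F) :
    (extensions (k + 1) ∅ S).card = 0 := by
  simp [extensions]

open Classical in
-- The branching step: either `x` is chosen or it is not. If it is, candidates incompatible with it
-- can be dropped, because subsets of weak Sidon sets are weak Sidon.
theorem card_extensions_insert [Add F] [DecidableEq F] {C S : Finset F} {x : F}
    (hx : x ∉ C) (k : ℕ) :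
    (extensions (k + 1) (insert x C) S).card = (extensions k
        (C.filter fun y => WeakSidon (insert y (insert x S))) (insert x S)).card +
      (extensions (k + 1) C S).card := by
  have h1 : extensions (k + 1) (insert x C) S = (extensions k
      (C.filter fun y => WeakSidon (insert y (insert x S))) (insert x S)).image (insert x) ∪
        extensions (k + 1) C S := by
    rw [extensions, Finset.powersetCard_succ_insert hx, Finset.filter_union, Finset.union_comm]
    congr 1
    rw [Finset.filter_image]
    congr 1
    ext T
    simp only [extensions, Finset.mem_filter, Finset.mem_powersetCard, Finset.union_insert,
      Finset.insert_union]
    constructor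
    · rintro ⟨⟨hTC, hT⟩, hs⟩
      refine ⟨⟨fun y hy => Finset.mem_filter.2 ⟨hTC hy, hs.mono ?_⟩, hT⟩, hs⟩
      intro z hz
      simp only [Finset.mem_insert, Finset.mem_union] at hz ⊢
      rcases hz with rfl | rfl | hz <;> tauto
    · rintro ⟨⟨hTC, hT⟩, hs⟩
      exact ⟨⟨fun y hy => (Finset.mem_filter.1 (hTC hy)).1, hT⟩, hs⟩
  have hnot : ∀ T ∈ extensions k
      (C.filter fun y => WeakSidon (insert y (insert x S))) (insert x S), x ∉ T :=
    fun T hT hxT => hx (Finset.mem_filter.1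
      ((Finset.mem_powersetCard.1 (Finset.mem_filter.1 hT).1).1 hxT)).1
  rw [h1, Finset.card_union_of_disjoint, Finset.card_image_of_injOn]
  · intro T hT U hU h
    rw [← Finset.erase_insert (hnot T hT), ← Finset.erase_insert (hnot U hU)]
    exact congrArg (Finset.erase · x) h
  · rw [Finset.disjoint_left]
    intro T hT hT'
    obtain ⟨U, -, rfl⟩ := Finset.mem_image.1 hT
    exact hx ((Finset.mem_powersetCard.1 (Finset.mem_filter.1 hT').1).1
      (Finset.mem_insert_self _ _))

end WeakSidon

/-! ### The search on bit masks and its correctness -/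

section Masks

/-- `f n`, arranged so that the kernel evaluates `n` before it substitutes it. -/
def force (n : ℕ) (f : ℕ → ℕ) : ℕ := Nat.rec (f 0) (fun k _ => f (Nat.succ k)) n

theorem force_eq (n : ℕ) (f : ℕ → ℕ) : force n f = f n := by
  cases n <;> rfl

/-- Cyclic shift of the `q`-bit mask `a` by `x`. -/
def rotate (q a x : ℕ) : ℕ :=
  Nat.mod (Nat.lor (Nat.shiftLeft a x) (Nat.shiftRight (Nat.shiftLeft a x) q)) (Nat.pow 2 q)

/-- Two consecutive copies of the `q`-bit mask `a`. -/
def double (q a : ℕ) : ℕ := Nat.lor a (Nat.shiftLeft a q)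

/-- The sum of `F x r` over the bits `x` of a mask, `r` being the mask of the bits below `x`. The
number of bits is at most the first explicit argument. -/
def sumBits (F : ℕ → ℕ → ℕ) (n : ℕ) : ℕ → ℕ :=
  Nat.rec (fun _ => 0) (fun _ ih c => Nat.rec 0 (fun d _ =>
    force (Nat.log2 (Nat.succ d)) fun x => force (Nat.mod (Nat.succ d) (Nat.pow 2 x)) fun r =>
      Nat.add (F x r) (ih r)) c) n

/-- The recursion step of `extCount`. -/
def extStep (q : ℕ) (next : ℕ → ℕ → ℕ → ℕ → ℕ → ℕ) (cand s n d p : ℕ) : ℕ :=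
  force s fun s => force n fun n => force d fun d => force p fun p =>
    sumBits (fun x r =>
      -- The mask removed from `r` consists of the `y` with `y - x` among the differences or `y + x`
      -- among the sums.
      next (Nat.xor r (Nat.land r
          (Nat.lor (Nat.shiftRight d (Nat.sub q x)) (Nat.shiftRight p x))))
        -- For `x = 0` the negative is bit `0`, not bit `q`; hence the reduction modulo `q`.
        (Nat.lor s (Nat.pow 2 x)) (Nat.lor n (Nat.pow 2 (Nat.mod (Nat.sub q x) q)))
        (Nat.lor d (double q (Nat.lor (rotate q n x) (rotate q s (Nat.sub q x)))))
        (Nat.lor p (double q (rotate q s x)))) q cand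

/-- The number of `k`-element sets of candidates (the mask `cand`) that extend a weak Sidon set to
a weak Sidon set. The weak Sidon set is given by the masks of its elements and of their negatives,
and by the doubled masks of its differences and of its sums. -/
def extCount (q k : ℕ) : ℕ → ℕ → ℕ → ℕ → ℕ → ℕ :=
  Nat.rec (fun _ _ _ _ _ => 1) (fun k' ih cand s n d p =>
    Nat.rec (sumBits (fun _ _ => 1) q cand) (fun _ _ => extStep q ih cand s n d p) k') k

theorem double_lor (q a b : ℕ) :
    Nat.lor (double q a) (double q b) = double q (Nat.lor a b) := by
  change (a ||| a <<< q) ||| (b ||| b <<< q) = (a ||| b) ||| (a ||| b) <<< q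
  rw [Nat.shiftLeft_or_distrib]
  ac_rfl

theorem extCount_add_two (q k c s n d p : ℕ) :
    extCount q (k + 1 + 1) c s n (double q d) (double q p) =
    sumBits (fun x r => extCount q (k + 1)
      (Nat.xor r (Nat.land r (Nat.lor (Nat.shiftRight (double q d) (Nat.sub q x))
        (Nat.shiftRight (double q p) x))))
      (Nat.lor s (Nat.pow 2 x)) (Nat.lor n (Nat.pow 2 (Nat.mod (Nat.sub q x) q)))
      (double q (Nat.lor d (Nat.lor (rotate q n x) (rotate q s (Nat.sub q x)))))
      (double q (Nat.lor p (rotate q s x)))) q c := by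
  change extStep q (extCount q (k + 1)) c s n (double q d) (double q p) = _
  simp only [extStep, force_eq, double_lor]

theorem two_pow_lt {q x : ℕ} (hx : x < q) : Nat.pow 2 x < 2 ^ q :=
  Nat.pow_lt_pow_right (by norm_num) hx

theorem lor_lt {q a b : ℕ} (ha : a < 2 ^ q) (hb : b < 2 ^ q) : Nat.lor a b < 2 ^ q :=
  Nat.or_lt_two_pow ha hb

theorem rotate_lt {q : ℕ} (a x : ℕ) : rotate q a x < 2 ^ q :=
  Nat.mod_lt _ (Nat.pow_pos (by norm_num))

theorem cast_sub_self {q x : ℕ} (hx : x ≤ q) :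
    ((Nat.sub q x : ℕ) : ZMod q) = -(x : ZMod q) := by
  rw [show Nat.sub q x = q - x from rfl, Nat.cast_sub hx, ZMod.natCast_self, zero_sub]

theorem log2_lt {c n : ℕ} (hc : c ≠ 0) (h : c < 2 ^ n) : Nat.log2 c < n :=
  (Nat.log2_lt hc).2 h

/-- Removing the top bit of a mask below `2 ^ (n + 1)` leaves one below `2 ^ n`, so the fuel `n`
suffices. The predicate `p` carries the invariant of the candidates. -/
theorem sumBits_eq {q : ℕ} {F : ℕ → ℕ → ℕ} {G : ℕ → ℕ} {p : ℕ → Prop} (h0 : G 0 = 0)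
    (h : ∀ c, c ≠ 0 → c < 2 ^ q → p c → p (Nat.mod c (Nat.pow 2 (Nat.log2 c))) ∧
      G c = F (Nat.log2 c) (Nat.mod c (Nat.pow 2 (Nat.log2 c))) +
        G (Nat.mod c (Nat.pow 2 (Nat.log2 c)))) :
    ∀ n ≤ q, ∀ c < 2 ^ n, p c → sumBits F n c = G c := by
  intro n
  induction n with
  | zero =>
    intro _ c hc _
    rw [show c = 0 by simpa using hc, h0]
    rfl
  | succ n ih =>
    intro hn c hc hp
    cases c with
    | zero => rw [h0]; rfl
    | succ d =>
      have hne : d + 1 ≠ 0 := by omega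
      obtain ⟨h1, h2⟩ := h (d + 1) hne
        (hc.trans_le (Nat.pow_le_pow_right (by norm_num) hn)) hp
      have hlt : Nat.mod (d + 1) (Nat.pow 2 (Nat.log2 (d + 1))) < 2 ^ n := by
        refine (Nat.mod_lt _ (Nat.pow_pos (by norm_num))).trans_le
          (Nat.pow_le_pow_right (by norm_num) ?_)
        have := log2_lt hne hc
        omega
      rw [h2, ← ih (by omega) _ hlt h1]
      have hunfold : sumBits F (n + 1) (d + 1) = force (Nat.log2 (Nat.succ d)) fun x =>
          force (Nat.mod (Nat.succ d) (Nat.pow 2 x)) fun r =>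
            Nat.add (F x r) (sumBits F n r) := rfl
      rw [hunfold, force_eq, force_eq]
      rfl

/-- The residues whose bits are set in a mask. -/
def bits (q : ℕ) [NeZero q] (c : ℕ) : Finset (ZMod q) :=
  Finset.univ.filter fun i => c.testBit i.val

variable {q : ℕ} [NeZero q]

theorem mem_bits {c : ℕ} {i : ZMod q} : i ∈ bits q c ↔ c.testBit i.val = true := by
  simp [bits]

theorem bits_zero : bits q 0 = ∅ := by
  ext; simp [mem_bits]

theorem bits_lor (a b : ℕ) : bits q (Nat.lor a b) = bits q a ∪ bits q b := by
  ext i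
  rw [Finset.mem_union, mem_bits, mem_bits, mem_bits, ← Bool.or_eq_true, ← Nat.testBit_or]
  rfl

theorem bits_xor_land (a b : ℕ) : bits q (Nat.xor a (Nat.land a b)) = bits q a \ bits q b := by
  ext i
  have h : (Nat.xor a (Nat.land a b)).testBit i.val =
      (a.testBit i.val ^^ (a.testBit i.val && b.testBit i.val)) := by
    rw [← Nat.testBit_and, ← Nat.testBit_xor]; rfl
  rw [Finset.mem_sdiff, mem_bits, mem_bits, mem_bits, h]
  cases a.testBit i.val <;> cases b.testBit i.val <;> simp

theorem mem_bits_two_pow {x : ℕ} (hx : x < q) {i : ZMod q} :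
    i ∈ bits q (Nat.pow 2 x) ↔ i = (x : ZMod q) := by
  have h : (Nat.pow 2 x).testBit i.val = decide (x = i.val) := Nat.testBit_two_pow
  rw [mem_bits, h, decide_eq_true_iff]
  constructor
  · rintro rfl
    rw [ZMod.natCast_zmod_val]
  · rintro rfl
    rw [ZMod.val_cast_of_lt hx]

/-- Rotation is translation of residues. The value `x = q` has to be allowed, since `Nat.sub q x` is
`q` for `x = 0`. -/
theorem mem_bits_rotate {a x : ℕ} (ha : a < 2 ^ q) (hx : x ≤ q) {i : ZMod q} :
    i ∈ bits q (rotate q a x) ↔ i - (x : ZMod q) ∈ bits q a := by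
  have hi := ZMod.val_lt i
  have h0 : rotate q a x = ((a <<< x) ||| ((a <<< x) >>> q)) % 2 ^ q := rfl
  rw [mem_bits, mem_bits, h0, Nat.testBit_mod_two_pow, Nat.testBit_or, Nat.testBit_shiftRight,
    Nat.testBit_shiftLeft, Nat.testBit_shiftLeft]
  have hbig : ∀ j, q ≤ j → a.testBit j = false := fun j hj =>
    Nat.testBit_lt_two_pow (ha.trans_le (Nat.pow_le_pow_right (by norm_num) hj))
  by_cases hxi : x ≤ i.val
  · have hval : (i - (x : ZMod q)).val = i.val - x := by
      have : i - (x : ZMod q) = ((i.val - x : ℕ) : ZMod q) := by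
        rw [Nat.cast_sub hxi, ZMod.natCast_zmod_val]
      rw [this, ZMod.val_cast_of_lt (by omega)]
    rw [hval, hbig (q + i.val - x) (by omega)]
    simp [hi, hxi]
  · have hval : (i - (x : ZMod q)).val = q + i.val - x := by
      have : i - (x : ZMod q) = ((q + i.val - x : ℕ) : ZMod q) := by
        rw [Nat.cast_sub (by omega), Nat.cast_add, ZMod.natCast_self, zero_add,
          ZMod.natCast_zmod_val]
      rw [this, ZMod.val_cast_of_lt (by omega)]
    rw [hval]
    simp [hi, hxi, show x ≤ q + i.val by omega]

/-- The second copy of the mask provides the bits that wrap around, so a plain shift acts as a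
translation on the lowest `q` bits. -/
theorem mem_bits_shiftRight_double {a x : ℕ} (ha : a < 2 ^ q) (hx : x ≤ q) {i : ZMod q} :
    i ∈ bits q (Nat.shiftRight (double q a) x) ↔ i + (x : ZMod q) ∈ bits q a := by
  have hi := ZMod.val_lt i
  have h0 : Nat.shiftRight (double q a) x = (a ||| (a <<< q)) >>> x := rfl
  rw [mem_bits, mem_bits, h0, Nat.testBit_shiftRight, Nat.testBit_or, Nat.testBit_shiftLeft]
  have hbig : ∀ j, q ≤ j → a.testBit j = false := fun j hj =>
    Nat.testBit_lt_two_pow (ha.trans_le (Nat.pow_le_pow_right (by norm_num) hj))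
  have hcast : i + (x : ZMod q) = ((x + i.val : ℕ) : ZMod q) := by
    rw [Nat.cast_add, ZMod.natCast_zmod_val, add_comm]
  by_cases hxi : x + i.val < q
  · rw [hcast, ZMod.val_cast_of_lt hxi]
    simp [show ¬ q ≤ x + i.val by omega]
  · have hval : (i + (x : ZMod q)).val = x + i.val - q := by
      have : i + (x : ZMod q) = ((x + i.val - q : ℕ) : ZMod q) := by
        rw [Nat.cast_sub (by omega), ZMod.natCast_self, sub_zero, hcast]
      rw [this, ZMod.val_cast_of_lt (by omega)]
    rw [hval, hbig (x + i.val) (by omega)]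
    simp [show q ≤ x + i.val by omega]

theorem bits_eq_insert {c : ℕ} (hc : c ≠ 0) (hcq : c < 2 ^ q) :
    ((Nat.log2 c : ℕ) : ZMod q) ∉ bits q (Nat.mod c (Nat.pow 2 (Nat.log2 c))) ∧
      bits q c = insert ((Nat.log2 c : ℕ) : ZMod q)
        (bits q (Nat.mod c (Nat.pow 2 (Nat.log2 c)))) := by
  have hx : Nat.log2 c < q := log2_lt hc hcq
  have htop : c.testBit (Nat.log2 c) = true := Nat.testBit_log2 hc
  have hmod : ∀ i : ZMod q, i ∈ bits q (Nat.mod c (Nat.pow 2 (Nat.log2 c))) ↔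
      i.val < Nat.log2 c ∧ c.testBit i.val = true := by
    intro i
    have : (Nat.mod c (Nat.pow 2 (Nat.log2 c))).testBit i.val =
        (decide (i.val < Nat.log2 c) && c.testBit i.val) := Nat.testBit_mod_two_pow ..
    rw [mem_bits, this]
    simp
  constructor
  · rw [hmod, ZMod.val_cast_of_lt hx]
    simp
  · ext i
    rw [Finset.mem_insert, hmod, mem_bits]
    constructor
    · intro h
      rcases lt_trichotomy i.val (Nat.log2 c) with hlt | heq | hgt
      · exact Or.inr ⟨hlt, h⟩
      · left
        rw [← heq, ZMod.natCast_zmod_val]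
      · have : c < 2 ^ i.val := (Nat.log2_lt hc).1 hgt
        rw [Nat.testBit_lt_two_pow this] at h
        exact absurd h (by simp)
    · rintro (rfl | h)
      · rw [ZMod.val_cast_of_lt hx]; exact htop
      · exact h.2

/-- The masks `s`, `n`, `d`, `p` describe the elements of `S`, their negatives, its differences
and its sums. -/
structure MaskRep (S : Finset (ZMod q)) (s n d p : ℕ) : Prop where
  s_lt : s < 2 ^ q
  n_lt : n < 2 ^ q
  d_lt : d < 2 ^ q
  p_lt : p < 2 ^ q
  mem_s : ∀ i, i ∈ bits q s ↔ i ∈ S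
  mem_n : ∀ i, i ∈ bits q n ↔ -i ∈ S
  mem_d : ∀ i, i ∈ bits q d ↔ ∃ a ∈ S, ∃ b ∈ S, a ≠ b ∧ i = a - b
  mem_p : ∀ i, i ∈ bits q p ↔ ∃ a ∈ S, ∃ b ∈ S, a ≠ b ∧ i = a + b

theorem MaskRep.insert {S : Finset (ZMod q)} {s n d p : ℕ} (h : MaskRep S s n d p) {x : ℕ}
    (hx : x < q) (hxS : (x : ZMod q) ∉ S) :
    MaskRep (insert (x : ZMod q) S) (Nat.lor s (Nat.pow 2 x))
      (Nat.lor n (Nat.pow 2 (Nat.mod (Nat.sub q x) q)))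
      (Nat.lor d (Nat.lor (rotate q n x) (rotate q s (Nat.sub q x))))
      (Nat.lor p (rotate q s x)) := by
  have hq : 0 < q := Nat.pos_of_neZero q
  have hy : Nat.mod (Nat.sub q x) q < q := Nat.mod_lt _ hq
  have hyc : ((Nat.mod (Nat.sub q x) q : ℕ) : ZMod q) = -(x : ZMod q) := by
    rw [← cast_sub_self hx.le]
    exact ZMod.natCast_mod _ _
  have hsub : ((Nat.sub q x : ℕ) : ZMod q) = -(x : ZMod q) := cast_sub_self hx.le
  have hne : ∀ a ∈ S, a ≠ (x : ZMod q) := fun a ha e => hxS (e ▸ ha)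
  refine ⟨lor_lt h.s_lt (two_pow_lt hx), lor_lt h.n_lt (two_pow_lt hy),
    lor_lt h.d_lt (lor_lt (rotate_lt _ _) (rotate_lt _ _)), lor_lt h.p_lt (rotate_lt _ _),
    fun i => ?_, fun i => ?_, fun i => ?_, fun i => ?_⟩
  · rw [bits_lor, Finset.mem_union, mem_bits_two_pow hx, h.mem_s, Finset.mem_insert, or_comm]
  · rw [bits_lor, Finset.mem_union, mem_bits_two_pow hy, h.mem_n, Finset.mem_insert, or_comm,
      hyc, neg_eq_iff_eq_neg]
  · rw [bits_lor, bits_lor, Finset.mem_union, Finset.mem_union, h.mem_d,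
      mem_bits_rotate h.n_lt hx.le,
      mem_bits_rotate h.s_lt (show Nat.sub q x ≤ q from Nat.sub_le q x), h.mem_n, h.mem_s,
      hsub]
    constructor
    · rintro (⟨a, ha, b, hb, hab, rfl⟩ | hi | hi)
      · exact ⟨a, Finset.mem_insert_of_mem ha, b, Finset.mem_insert_of_mem hb, hab, rfl⟩
      · exact ⟨x, Finset.mem_insert_self _ _, _, Finset.mem_insert_of_mem hi, (hne _ hi).symm,
          by ring⟩
      · exact ⟨_, Finset.mem_insert_of_mem hi, x, Finset.mem_insert_self _ _, hne _ hi, by ring⟩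
    · rintro ⟨a, ha, b, hb, hab, rfl⟩
      rcases Finset.mem_insert.1 ha with rfl | ha
      · rcases Finset.mem_insert.1 hb with rfl | hb
        · exact absurd rfl hab
        · right; left
          convert hb using 1
          ring
      · rcases Finset.mem_insert.1 hb with rfl | hb
        · right; right
          convert ha using 1
          ring
        · exact Or.inl ⟨a, ha, b, hb, hab, rfl⟩
  · rw [bits_lor, Finset.mem_union, h.mem_p, mem_bits_rotate h.s_lt hx.le, h.mem_s]
    constructor
    · rintro (⟨a, ha, b, hb, hab, rfl⟩ | hi)
      · exact ⟨a, Finset.mem_insert_of_mem ha, b, Finset.mem_insert_of_mem hb, hab, rfl⟩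
      · exact ⟨x, Finset.mem_insert_self _ _, _, Finset.mem_insert_of_mem hi, (hne _ hi).symm,
          by ring⟩
    · rintro ⟨a, ha, b, hb, hab, rfl⟩
      rcases Finset.mem_insert.1 ha with rfl | ha
      · rcases Finset.mem_insert.1 hb with rfl | hb
        · exact absurd rfl hab
        · right
          convert hb using 1
          ring
      · rcases Finset.mem_insert.1 hb with rfl | hb
        · right
          convert ha using 1
          ring
        · exact Or.inl ⟨a, ha, b, hb, hab, rfl⟩

theorem sumBits_one {c : ℕ} (hc : c < 2 ^ q) : sumBits (fun _ _ => 1) q c = (bits q c).card := by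
  refine sumBits_eq (q := q) (p := fun _ => True) (G := fun c => (bits q c).card)
    (by simp [bits_zero]) ?_ q le_rfl c hc trivial
  intro c hc hcq _
  refine ⟨trivial, ?_⟩
  obtain ⟨h1, h2⟩ := bits_eq_insert hc hcq
  rw [h2, Finset.card_insert_of_notMem h1, add_comm]

/-- The invariant is that each candidate lies outside `S` and extends it on its own. Peeling off the
top candidate is `card_extensions_insert`, and the surviving mask is given by
`weakSidon_insert_insert`. -/
theorem extCount_eq (k : ℕ) : ∀ (S : Finset (ZMod q)) (c s n d p : ℕ), MaskRep S s n d p →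
    WeakSidon S → c < 2 ^ q → (∀ y ∈ bits q c, y ∉ S ∧ WeakSidon (insert y S)) →
    extCount q k c s n (double q d) (double q p) = (extensions k (bits q c) S).card := by
  classical
  induction k with
  | zero =>
    intro S c s n d p _ hS _ _
    rw [card_extensions_zero hS]
    rfl
  | succ k ih =>
    intro S c s n d p hrep hS hc hcS
    cases k with
    | zero =>
      rw [card_extensions_one fun y hy => (hcS y hy).2, ← sumBits_one hc]
      rfl
    | succ k =>
      rw [extCount_add_two]
      refine sumBits_eq (q := q) (G := fun c => (extensions (k + 1 + 1) (bits q c) S).card)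
        (p := fun c => ∀ y ∈ bits q c, y ∉ S ∧ WeakSidon (insert y S)) ?_ ?_ q le_rfl c hc hcS
      · rw [bits_zero, card_extensions_empty]
      · intro c hc0 hc hcS
        obtain ⟨h1, h2⟩ := bits_eq_insert hc0 hc
        have hx : Nat.log2 c < q := log2_lt hc0 hc
        have hr : Nat.mod c (Nat.pow 2 (Nat.log2 c)) < 2 ^ q := (Nat.mod_le _ _).trans_lt hc
        generalize Nat.mod c (Nat.pow 2 (Nat.log2 c)) = r at *
        generalize Nat.log2 c = x at *
        have hxS := hcS x (h2 ▸ Finset.mem_insert_self _ _)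
        have hrS : ∀ y ∈ bits q r, y ∉ S ∧ WeakSidon (Insert.insert y S) := fun y hy =>
          hcS y (h2 ▸ Finset.mem_insert_of_mem hy)
        refine ⟨hrS, ?_⟩
        rw [h2, card_extensions_insert h1]
        congr 1
        have hrep' := hrep.insert hx hxS.1
        have hbits : bits q (Nat.xor r (Nat.land r
            (Nat.lor (Nat.shiftRight (double q d) (Nat.sub q x))
              (Nat.shiftRight (double q p) x)))) =
            (bits q r).filter fun y =>
              WeakSidon (Insert.insert y (Insert.insert (x : ZMod q) S)) := by
          ext y
          rw [bits_xor_land, Finset.mem_sdiff, Finset.mem_filter]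
          refine and_congr_right fun hy => ?_
          have hyx : (x : ZMod q) ≠ y := fun e => h1 (e ▸ hy)
          rw [weakSidon_insert_insert hxS.1 (hrS y hy).1 hyx hxS.2 (hrS y hy).2, bits_lor,
            Finset.mem_union, mem_bits_shiftRight_double hrep.p_lt hx.le,
            mem_bits_shiftRight_double hrep.d_lt (show Nat.sub q x ≤ q from Nat.sub_le q x),
            hrep.mem_d, hrep.mem_p, not_or, cast_sub_self hx.le, ← sub_eq_add_neg]
        rw [← hbits]
        refine (ih _ _ _ _ _ _ hrep' hxS.2 ?_ ?_).symm
        · exact Nat.xor_lt_two_pow hr (Nat.and_le_left.trans_lt hr)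
        · intro y hy
          rw [hbits, Finset.mem_filter] at hy
          refine ⟨fun hmem => ?_, hy.2⟩
          rcases Finset.mem_insert.1 hmem with rfl | hmem
          · exact h1 hy.1
          · exact (hrS y hy.1).1 hmem

end Masks

/-! ### Reduction of the point count to sets containing `0` and `1` -/

section Counting

theorem weakSidon_of_card_lt_four {F : Type*} [Add F] {S : Finset F} (hS : S.card < 4) :
    WeakSidon S := by
  classical
  intro a ha b hb c hc d hd hn
  exfalso
  have h1 : [a, b, c, d].toFinset ⊆ S := by
    intro z hz
    simp only [List.mem_toFinset, List.mem_cons, List.not_mem_nil, or_false] at hz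
    rcases hz with rfl | rfl | rfl | rfl <;> assumption
  have h2 := Finset.card_le_card h1
  rw [List.toFinset_card_of_nodup hn] at h2
  simp at h2
  omega

theorem weakSidon_image_affine {F : Type*} [Field F] [DecidableEq F] {S : Finset F}
    (hS : WeakSidon S) (a : F) {c : F} (hc : c ≠ 0) :
    WeakSidon (S.image fun z => a + c * z) := by
  intro u hu v hv w hw z hz hn he
  obtain ⟨u', hu', rfl⟩ := Finset.mem_image.1 hu
  obtain ⟨v', hv', rfl⟩ := Finset.mem_image.1 hv
  obtain ⟨w', hw', rfl⟩ := Finset.mem_image.1 hw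
  obtain ⟨z', hz', rfl⟩ := Finset.mem_image.1 hz
  refine hS u' hu' v' hv' w' hw' z' hz'
    (List.Nodup.of_map (l := [u', v', w', z']) (fun z => a + c * z) hn) ?_
  refine mul_left_cancel₀ hc ?_
  linear_combination he

open Classical in
/-- The weak Sidon sets with `m` elements. -/
noncomputable def weakSidonSets (F : Type*) [Add F] [Fintype F] (m : ℕ) : Finset (Finset F) :=
  (Finset.univ.powersetCard m).filter WeakSidon

theorem mem_weakSidonSets {F : Type*} [Add F] [Fintype F] {m : ℕ} {S : Finset F} :
    S ∈ weakSidonSets F m ↔ S.card = m ∧ WeakSidon S := by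
  simp [weakSidonSets]

/-- Admissibility of a tuple depends only on its set of values once the entries are distinct; each
set has `m!` enumerations. -/
theorem card_tuples_eq_factorial_mul {F : Type*} [CommRing F] [Fintype F] [DecidableEq F]
    (m : ℕ) :
    (Finset.univ.filter fun x : Fin m → F => ∀ c ∈ midVectors m, form F c x ≠ 0).card =
      m.factorial * (weakSidonSets F m).card := by
  classical
  rw [Finset.card_eq_sum_card_fiberwise (f := fun x : Fin m → F => Finset.univ.image x)
    (t := weakSidonSets F m)]
  · rw [Finset.sum_const_nat (m := m.factorial), mul_comm]
    intro S hS
    obtain ⟨hcard, hsid⟩ := mem_weakSidonSets.1 hS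
    have e : Fin m ≃ S := Fintype.equivOfCardEq (by simp [hcard])
    have h1 : (Finset.univ : Finset (Fin m ≃ S)).card = m.factorial := by
      rw [Finset.card_univ, Fintype.card_equiv e, Fintype.card_fin]
    rw [← h1]
    symm
    refine Finset.card_bij (fun e _ i => (e i : F)) ?_ ?_ ?_
    · intro e _
      simp only [Finset.mem_filter, Finset.mem_univ, true_and, forall_form_ne_zero_iff]
      have hinj : Function.Injective fun i => (e i : F) :=
        Subtype.val_injective.comp e.injective
      refine ⟨⟨hinj, fun p q r s hn => ?_⟩, ?_⟩
      · exact hsid _ (e p).2 _ (e q).2 _ (e r).2 _ (e s).2 (hn.map hinj)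
      · ext z
        simp only [Finset.mem_image, Finset.mem_univ, true_and]
        constructor
        · rintro ⟨i, rfl⟩; exact (e i).2
        · intro hz; exact ⟨e.symm ⟨z, hz⟩, by simp⟩
    · intro e _ e' _ h
      ext i
      exact congrFun h i
    · intro x hx
      simp only [Finset.mem_filter, Finset.mem_univ, true_and, forall_form_ne_zero_iff] at hx
      obtain ⟨⟨hinj, -⟩, him⟩ := hx
      have hmem : ∀ i, x i ∈ S := fun i => him ▸ Finset.mem_image_of_mem x (Finset.mem_univ i)
      refine ⟨Equiv.ofBijective (fun i => ⟨x i, hmem i⟩) ⟨fun i j h => hinj (by simpa using h),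
        fun z => ?_⟩, Finset.mem_univ _, rfl⟩
      have hz : (z : F) ∈ Finset.univ.image x := him.symm ▸ z.2
      obtain ⟨i, -, hi⟩ := Finset.mem_image.1 hz
      exact ⟨i, Subtype.ext hi⟩
  · intro x hx
    simp only [Finset.coe_filter, Finset.mem_univ, true_and, Set.mem_ofPred_eq,
      forall_form_ne_zero_iff] at hx
    rw [Finset.mem_coe, mem_weakSidonSets, Finset.card_image_of_injective _ hx.1]
    refine ⟨by simp, ?_⟩
    intro a ha b hb c hc d hd hn
    obtain ⟨p, -, rfl⟩ := Finset.mem_image.1 ha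
    obtain ⟨q, -, rfl⟩ := Finset.mem_image.1 hb
    obtain ⟨r, -, rfl⟩ := Finset.mem_image.1 hc
    obtain ⟨s, -, rfl⟩ := Finset.mem_image.1 hd
    exact hx.2 p q r s (List.Nodup.of_map (l := [p, q, r, s]) x hn)

open Classical in
-- The affine bijection `z ↦ a + (b - a) z` takes `0, 1` to `a, b` and preserves weak Sidon sets.
theorem card_weakSidonSets_mem_mem {F : Type*} [Field F] [Fintype F] (m : ℕ) {a b : F}
    (hab : a ≠ b) :
    ((weakSidonSets F m).filter fun S => a ∈ S ∧ b ∈ S).card =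
      ((weakSidonSets F m).filter fun S => 0 ∈ S ∧ 1 ∈ S).card := by
  have hc : b - a ≠ 0 := sub_ne_zero.2 hab.symm
  have hinv : ∀ z, -a / (b - a) + (b - a)⁻¹ * (a + (b - a) * z) = z := fun z => by
    field_simp; ring
  have hinv' : ∀ z, a + (b - a) * (-a / (b - a) + (b - a)⁻¹ * z) = z := fun z => by
    field_simp; ring
  have hinj : Function.Injective fun z => a + (b - a) * z := fun u v h => by
    rw [← hinv u, ← hinv v]; exact congrArg (fun w => -a / (b - a) + (b - a)⁻¹ * w) h
  have hinj' : Function.Injective fun z => -a / (b - a) + (b - a)⁻¹ * z := fun u v h => by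
    rw [← hinv' u, ← hinv' v]; exact congrArg (fun w => a + (b - a) * w) h
  symm
  refine Finset.card_nbij' (fun S => S.image fun z => a + (b - a) * z)
    (fun S => S.image fun z => -a / (b - a) + (b - a)⁻¹ * z) ?_ ?_ ?_ ?_
  · intro S hS
    simp only [Finset.coe_filter, Set.mem_ofPred_eq, mem_weakSidonSets] at hS ⊢
    refine ⟨⟨(Finset.card_image_of_injective _ hinj).trans hS.1.1,
      weakSidon_image_affine hS.1.2 _ hc⟩, Finset.mem_image.2 ⟨0, hS.2.1, by simp⟩,
      Finset.mem_image.2 ⟨1, hS.2.2, by simp⟩⟩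
  · intro S hS
    simp only [Finset.coe_filter, Set.mem_ofPred_eq, mem_weakSidonSets] at hS ⊢
    refine ⟨⟨(Finset.card_image_of_injective _ hinj').trans hS.1.1,
      weakSidon_image_affine hS.1.2 _ (inv_ne_zero hc)⟩,
      Finset.mem_image.2 ⟨a, hS.2.1, by field_simp; ring⟩,
      Finset.mem_image.2 ⟨b, hS.2.2, by field_simp; ring⟩⟩
  · intro S _
    exact Finset.image_image.trans
      ((congrArg (fun f => Finset.image f S) (funext hinv)).trans Finset.image_id')
  · intro S _
    exact Finset.image_image.trans
      ((congrArg (fun f => Finset.image f S) (funext hinv')).trans Finset.image_id')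

open Classical in
-- Double counting of weak Sidon sets together with an ordered pair of distinct elements.
theorem card_weakSidonSets_mul {F : Type*} [Field F] [Fintype F] (m : ℕ) :
    (weakSidonSets F m).card * (m * m - m) = (Fintype.card F * Fintype.card F - Fintype.card F) *
      ((weakSidonSets F m).filter fun S => 0 ∈ S ∧ 1 ∈ S).card := by
  have h := Finset.sum_card_bipartiteAbove_eq_sum_card_bipartiteBelow
    (s := weakSidonSets F m) (t := (Finset.univ : Finset F).offDiag)
    (fun (S : Finset F) (z : F × F) => z.1 ∈ S ∧ z.2 ∈ S)
  rw [Finset.sum_const_nat (m := m * m - m), Finset.sum_const_nat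
    (m := ((weakSidonSets F m).filter fun S => 0 ∈ S ∧ 1 ∈ S).card), Finset.offDiag_card,
    Finset.card_univ] at h
  · exact h
  · intro z hz
    exact card_weakSidonSets_mem_mem m (Finset.mem_offDiag.1 hz).2.2
  · intro S hS
    rw [← (mem_weakSidonSets.1 hS).1, ← Finset.offDiag_card]
    congr 1
    ext z
    simp [Finset.bipartiteAbove, Finset.mem_offDiag]
    tauto

open Classical in
theorem card_weakSidonSets_zero_one {F : Type*} [Field F] [Fintype F] (k : ℕ) :
    ((weakSidonSets F (k + 2)).filter fun S => 0 ∈ S ∧ 1 ∈ S).card =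
      (extensions k (Finset.univ \ {1, 0} : Finset F) {1, 0}).card := by
  have h01 : (1 : F) ≠ 0 := one_ne_zero
  have hpair : ({1, 0} : Finset F).card = 2 := Finset.card_pair h01
  refine Finset.card_nbij' (fun S => S \ {1, 0}) (fun T => {1, 0} ∪ T) ?_ ?_ ?_ ?_
  · intro S hS
    simp only [Finset.coe_filter, Set.mem_ofPred_eq, mem_weakSidonSets] at hS
    have hsub : ({1, 0} : Finset F) ⊆ S := by
      intro z hz
      simp only [Finset.mem_insert, Finset.mem_singleton] at hz
      rcases hz with rfl | rfl
      · exact hS.2.2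
      · exact hS.2.1
    refine Finset.mem_coe.2 (Finset.mem_filter.2 ⟨Finset.mem_powersetCard.2
      ⟨Finset.sdiff_subset_sdiff (Finset.subset_univ _) subset_rfl, ?_⟩, ?_⟩)
    · rw [Finset.card_sdiff_of_subset hsub, hS.1.1, hpair]
      rfl
    · rw [Finset.union_sdiff_of_subset hsub]
      exact hS.1.2
  · intro T hT
    obtain ⟨hT, hs⟩ := Finset.mem_filter.1 (Finset.mem_coe.1 hT)
    obtain ⟨hT, hk⟩ := Finset.mem_powersetCard.1 hT
    refine Finset.mem_coe.2 (Finset.mem_filter.2 ⟨mem_weakSidonSets.2 ⟨?_, hs⟩, by simp,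
      by simp⟩)
    rw [Finset.card_union_of_disjoint, hpair, hk, add_comm]
    exact Finset.disjoint_left.2 fun z hz hz' => (Finset.mem_sdiff.1 (hT hz')).2 hz
  · intro S hS
    simp only [Finset.coe_filter, Set.mem_ofPred_eq, mem_weakSidonSets] at hS
    refine Finset.union_sdiff_of_subset fun z hz => ?_
    simp only [Finset.mem_insert, Finset.mem_singleton] at hz
    rcases hz with rfl | rfl
    · exact hS.2.2
    · exact hS.2.1
  · intro T hT
    obtain ⟨hT, -⟩ := Finset.mem_filter.1 (Finset.mem_coe.1 hT)
    obtain ⟨hT, -⟩ := Finset.mem_powersetCard.1 hT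
    refine Finset.union_sdiff_cancel_left ?_
    exact Finset.disjoint_left.2 fun z hz hz' => (Finset.mem_sdiff.1 (hT hz')).2 hz

/-- The number of `k`-element sets that extend `{0, 1}` to a weak Sidon set of residues
modulo `q`. -/
def extCountZeroOne (q k : ℕ) : ℕ :=
  extCount q k (Nat.shiftLeft (2 ^ (q - 2) - 1) 2)
    (Nat.lor 1 2) (Nat.lor 1 (2 ^ (q - 1))) (double q (Nat.lor 2 (2 ^ (q - 1)))) (double q 2)

theorem maskRep_zero_one {q : ℕ} [hq : Fact q.Prime] (h2 : 2 < q) :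
    MaskRep ({1, 0} : Finset (ZMod q)) (Nat.lor 1 2) (Nat.lor 1 (2 ^ (q - 1)))
      (Nat.lor 2 (2 ^ (q - 1))) 2 := by
  have b1 : ∀ i : ZMod q, i ∈ bits q 1 ↔ i = 0 := fun i => by
    simpa using mem_bits_two_pow (q := q) (x := 0) (by omega) (i := i)
  have b2 : ∀ i : ZMod q, i ∈ bits q 2 ↔ i = 1 := fun i => by
    simpa using mem_bits_two_pow (q := q) (x := 1) (by omega) (i := i)
  have b3 : ∀ i : ZMod q, i ∈ bits q (2 ^ (q - 1)) ↔ i = -1 := fun i => by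
    have := mem_bits_two_pow (q := q) (x := q - 1) (by omega) (i := i)
    rwa [show ((q - 1 : ℕ) : ZMod q) = -1 by simpa using cast_sub_self (q := q) (x := 1) (by omega)]
      at this
  have l1 : 1 < 2 ^ q := two_pow_lt (x := 0) (by omega)
  have l2 : 2 < 2 ^ q := two_pow_lt (x := 1) (by omega)
  have l3 : 2 ^ (q - 1) < 2 ^ q := two_pow_lt (x := q - 1) (by omega)
  refine ⟨lor_lt l1 l2, lor_lt l1 l3, lor_lt l2 l3, l2, fun i => ?_, fun i => ?_, fun i => ?_,
    fun i => ?_⟩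
  · rw [bits_lor, Finset.mem_union, b1, b2]
    simp [or_comm]
  · rw [bits_lor, Finset.mem_union, b1, b3]
    simp [neg_eq_iff_eq_neg, or_comm]
  · rw [bits_lor, Finset.mem_union, b2, b3]
    simp
  · rw [b2]
    simp

theorem extCountZeroOne_eq {q : ℕ} [hq : Fact q.Prime] (h2 : 2 < q) (k : ℕ) :
    extCountZeroOne q k =
      (extensions k (Finset.univ \ {1, 0} : Finset (ZMod q)) {1, 0}).card := by
  have hbits : bits q (Nat.shiftLeft (2 ^ (q - 2) - 1) 2) =
      (Finset.univ \ {1, 0} : Finset (ZMod q)) := by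
    ext i
    have hi := ZMod.val_lt i
    have h1 : i = 1 ↔ i.val = 1 := by
      rw [← (ZMod.val_injective q).eq_iff, ZMod.val_one'' (by omega)]
    have h0 : i = 0 ↔ i.val = 0 := (ZMod.val_eq_zero i).symm
    have h : (Nat.shiftLeft (2 ^ (q - 2) - 1) 2).testBit i.val =
        (decide (i.val ≥ 2) && (2 ^ (q - 2) - 1).testBit (i.val - 2)) := Nat.testBit_shiftLeft ..
    rw [mem_bits, h, Nat.testBit_two_pow_sub_one]
    simp only [Bool.and_eq_true, decide_eq_true_eq, Finset.mem_sdiff, Finset.mem_univ,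
      Finset.mem_insert, Finset.mem_singleton, h1, h0, true_and]
    omega
  have hcard : ∀ y : ZMod q, (insert y ({1, 0} : Finset (ZMod q))).card < 4 := fun y =>
    (Finset.card_le_three).trans_lt (by norm_num)
  rw [extCountZeroOne, extCount_eq k _ _ _ _ _ _ (maskRep_zero_one h2), hbits]
  · exact weakSidon_of_card_lt_four (Finset.card_le_two.trans_lt (by norm_num))
  · have : (2 : ℕ) ^ q = 2 ^ (q - 2) * 2 ^ 2 := by rw [← pow_add]; congr 1; omega
    have hpos : 0 < 2 ^ (q - 2) := by positivity
    change (2 ^ (q - 2) - 1) <<< 2 < 2 ^ q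
    rw [Nat.shiftLeft_eq, this]
    exact Nat.mul_lt_mul_of_pos_right (by omega) (by norm_num)
  · intro y hy
    rw [hbits, Finset.mem_sdiff] at hy
    exact ⟨hy.2, weakSidon_of_card_lt_four (hcard y)⟩

/-- The characteristic polynomial of the mid-hyperplane arrangement at a large prime. -/
theorem eval_charPoly_eq_extCountZeroOne {q k : ℕ} [hq : Fact q.Prime] (h2 : 2 < q)
    (hqm : ¬ q ∣ k + 2) (hbound : 4 ^ (k + 1) < (k + 2) * q ^ 2) :
    (charPoly (midArrangement (k + 2))).eval (q : ℤ) =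
      q * (q - 1) * (k.factorial * extCountZeroOne q k : ℕ) := by
  classical
  rw [eval_charPoly_midArrangement (by omega) hqm hbound, card_tuples_eq_factorial_mul]
  have h := card_weakSidonSets_mul (F := ZMod q) (k + 2)
  rw [card_weakSidonSets_zero_one, ZMod.card] at h
  have h3 := extCountZeroOne_eq h2 k
  have e1 : (k + 2) * (k + 2) - (k + 2) = (k + 2) * (k + 1) := by
    rw [← Nat.mul_sub_one]; rfl
  have e2 : q * q - q = q * (q - 1) := (Nat.mul_sub_one _ _).symm
  have h4 : (weakSidonSets (ZMod q) (k + 2)).card * ((k + 2) * (k + 1)) =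
      q * (q - 1) * extCountZeroOne q k := by
    rw [h3, ← e1, ← e2]
    convert h
  have h5 : (k + 2).factorial * (weakSidonSets (ZMod q) (k + 2)).card =
      q * (q - 1) * (k.factorial * extCountZeroOne q k) := by
    rw [Nat.factorial_succ, Nat.factorial_succ]
    linear_combination k.factorial * h4
  rw [h5]
  push_cast [Nat.cast_sub (show 1 ≤ q by omega)]
  ring

end Counting

/-! ### Evaluation at primes and the table -/

section FinalTable

/-- The characteristic polynomial is determined by the counts at `k` large primes. -/
theorem charPoly_eq_of_extCountZeroOne {k : ℕ} {P : ℤ[X]} (hP : P.Monic)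
    (hdeg : P.natDegree = k + 2) (h0 : P.eval 0 = 0) (h1 : P.eval 1 = 0) {s : Finset ℕ}
    (hs : s.card = k) (hsq : ∀ q ∈ s, q.Prime ∧ 2 < q ∧ ¬ q ∣ k + 2 ∧
      4 ^ (k + 1) < (k + 2) * q ^ 2 ∧
      P.eval (q : ℤ) = q * (q - 1) * (k.factorial * extCountZeroOne q k : ℕ)) :
    charPoly (midArrangement (k + 2)) = P := by
  classical
  have hcast : ∀ a ∈ s.image ((↑) : ℕ → ℤ), ∃ q ∈ s, (q : ℤ) = a := by simp
  refine charPoly_midArrangement_eq_of_eval hP hdeg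
    (s := insert 0 (insert 1 (s.image ((↑) : ℕ → ℤ)))) ?_ ?_
  · rw [Finset.card_insert_of_notMem, Finset.card_insert_of_notMem,
      Finset.card_image_of_injective _ Nat.cast_injective, hs]
    · intro h
      obtain ⟨q, hq, hq1⟩ := hcast _ h
      have := (hsq q hq).2.1
      omega
    · intro h
      rcases Finset.mem_insert.1 h with h | h
      · exact zero_ne_one h
      obtain ⟨q, hq, hq1⟩ := hcast _ h
      have := (hsq q hq).2.1
      omega
  · intro a ha
    rcases Finset.mem_insert.1 ha with rfl | ha
    · rw [h0, eval_zero_charPoly_midArrangement (by omega)]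
    rcases Finset.mem_insert.1 ha with rfl | ha
    · rw [h1, eval_one_charPoly_midArrangement (by omega)]
    obtain ⟨q, hq, rfl⟩ := hcast a ha
    obtain ⟨hp, h2, hqm, hb, he⟩ := hsq q hq
    have : Fact q.Prime := ⟨hp⟩
    rw [he, eval_charPoly_eq_extCountZeroOne h2 hqm hb]

theorem chambers_midArrangement_ncard (m : ℕ) :
    ((chambers (midArrangement m)).ncard : ℤ) =
      (-1) ^ m * (charPoly (midArrangement m)).eval (-1) := by
  classical
  rw [midArrangement_eq, chambers_ncard_eq_eval _ _ fun c hc => form_ne_zero_of_mem_midVectors hc,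
    Module.finrank_fin_fun]

/-- The numbers of chambers and of ranking patterns follow from the characteristic polynomial. -/
theorem counts_of_charPoly {m r : ℕ} {P : ℤ[X]} (h : charPoly (midArrangement m) = P)
    (hr : (-1) ^ m * P.eval (-1) = (m.factorial * r : ℕ)) :
    (chambers (midArrangement m)).ncard = m.factorial * r ∧ numRankingPatterns m = r := by
  have h1 : (chambers (midArrangement m)).ncard = m.factorial * r := by
    have := chambers_midArrangement_ncard m
    rw [h, hr] at this
    exact_mod_cast this
  refine ⟨h1, Nat.eq_of_mul_eq_mul_left m.factorial_pos ?_⟩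
  rw [factorial_mul_numRankingPatterns, h1]

/-- For `m = k + 2` the primes used are the `k` smallest odd ones with `q ∤ m` and `4^(m-1) < m q²`.
The two zero counts reflect the roots `5` for `m = 4` and `17` for `m = 6`. -/
theorem extCount_5_1 : extCountZeroOne 5 1 = 3 := by decide +kernel
theorem extCount_5_2 : extCountZeroOne 5 2 = 0 := by decide +kernel
theorem extCount_7_2 : extCountZeroOne 7 2 = 4 := by decide +kernel
theorem extCount_11_3 : extCountZeroOne 11 3 = 4 := by decide +kernel
theorem extCount_13_3 : extCountZeroOne 13 3 = 20 := by decide +kernel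
theorem extCount_17_3 : extCountZeroOne 17 3 = 120 := by decide +kernel
theorem extCount_17_4 : extCountZeroOne 17 4 = 0 := by decide +kernel
theorem extCount_19_4 : extCountZeroOne 19 4 = 10 := by decide +kernel
theorem extCount_23_4 : extCountZeroOne 23 4 = 180 := by decide +kernel
theorem extCount_29_4 : extCountZeroOne 29 4 = 1680 := by decide +kernel
theorem extCount_29_5 : extCountZeroOne 29 5 = 6 := by decide +kernel
theorem extCount_31_5 : extCountZeroOne 31 5 = 56 := by decide +kernel
theorem extCount_37_5 : extCountZeroOne 37 5 = 2002 := by decide +kernel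
theorem extCount_41_5 : extCountZeroOne 41 5 = 8568 := by decide +kernel
theorem extCount_43_5 : extCountZeroOne 43 5 = 15504 := by decide +kernel

theorem charPoly_midArrangement_three :
    charPoly (midArrangement 3) = X * (X - 1) * (X - 2) := by
  refine charPoly_eq_of_extCountZeroOne (k := 1) (s := {5}) (by monicity!)
    (by compute_degree!) (by simp) (by simp) rfl ?_
  simp only [Finset.mem_singleton, forall_eq]
  norm_num [extCount_5_1, Nat.factorial]

theorem charPoly_midArrangement_four :
    charPoly (midArrangement 4) = X * (X - 1) * (X - 3) * (X - 5) := by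
  refine charPoly_eq_of_extCountZeroOne (k := 2) (s := {5, 7}) (by monicity!)
    (by compute_degree!) (by simp) (by simp) rfl ?_
  simp only [Finset.mem_insert, Finset.mem_singleton, forall_eq_or_imp, forall_eq]
  norm_num [extCount_5_2, extCount_7_2, Nat.factorial]

theorem charPoly_midArrangement_five :
    charPoly (midArrangement 5) = X * (X - 1) * (X - 7) * (X - 8) * (X - 9) := by
  refine charPoly_eq_of_extCountZeroOne (k := 3) (s := {11, 13, 17}) (by monicity!)
    (by compute_degree!) (by simp) (by simp) rfl ?_
  simp only [Finset.mem_insert, Finset.mem_singleton, forall_eq_or_imp, forall_eq]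
  norm_num [extCount_11_3, extCount_13_3, extCount_17_3, Nat.factorial]

theorem charPoly_midArrangement_six :
    charPoly (midArrangement 6) =
      X * (X - 1) * (X - 13) * (X - 14) * (X - 15) * (X - 17) := by
  refine charPoly_eq_of_extCountZeroOne (k := 4) (s := {17, 19, 23, 29}) (by monicity!)
    (by compute_degree!) (by simp) (by simp) rfl ?_
  simp only [Finset.mem_insert, Finset.mem_singleton, forall_eq_or_imp, forall_eq]
  norm_num [extCount_17_4, extCount_19_4, extCount_23_4, extCount_29_4, Nat.factorial]

theorem charPoly_midArrangement_seven :
    charPoly (midArrangement 7) =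
      X * (X - 1) * (X - 23) * (X - 24) * (X - 25) * (X - 26) * (X - 27) := by
  refine charPoly_eq_of_extCountZeroOne (k := 5) (s := {29, 31, 37, 41, 43}) (by monicity!)
    (by compute_degree!) (by simp) (by simp) rfl ?_
  simp only [Finset.mem_insert, Finset.mem_singleton, forall_eq_or_imp, forall_eq]
  norm_num [extCount_29_5, extCount_31_5, extCount_37_5, extCount_41_5, extCount_43_5,
    Nat.factorial]

end FinalTable

end RankingPattern


theorem theorem3p1 :
    (charPoly (midArrangement 3) = X * (X - 1) * (X - 2) ∧
      (chambers (midArrangement 3)).ncard = 6 ∧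
      numRankingPatterns 3 = 1) ∧
    (charPoly (midArrangement 4) = X * (X - 1) * (X - 3) * (X - 5) ∧
      (chambers (midArrangement 4)).ncard = 48 ∧
      numRankingPatterns 4 = 2) ∧
    (charPoly (midArrangement 5) = X * (X - 1) * (X - 7) * (X - 8) * (X - 9) ∧
      (chambers (midArrangement 5)).ncard = 1440 ∧
      numRankingPatterns 5 = 12) ∧
    (charPoly (midArrangement 6) =
        X * (X - 1) * (X - 13) * (X - 14) * (X - 15) * (X - 17) ∧
      (chambers (midArrangement 6)).ncard = 120960 ∧
      numRankingPatterns 6 = 168) ∧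
    (charPoly (midArrangement 7) =
        X * (X - 1) * (X - 23) * (X - 24) * (X - 25) * (X - 26) * (X - 27) ∧
      (chambers (midArrangement 7)).ncard = 23587200 ∧
      numRankingPatterns 7 = 4680) := by
  refine ⟨⟨charPoly_midArrangement_three, ?_⟩, ⟨charPoly_midArrangement_four, ?_⟩,
    ⟨charPoly_midArrangement_five, ?_⟩, ⟨charPoly_midArrangement_six, ?_⟩,
    ⟨charPoly_midArrangement_seven, ?_⟩⟩
  · exact counts_of_charPoly (r := 1) charPoly_midArrangement_three
      (by norm_num [Nat.factorial])
  · exact counts_of_charPoly (r := 2) charPoly_midArrangement_four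
      (by norm_num [Nat.factorial])
  · exact counts_of_charPoly (r := 12) charPoly_midArrangement_five
      (by norm_num [Nat.factorial])
  · exact counts_of_charPoly (r := 168) charPoly_midArrangement_six
      (by norm_num [Nat.factorial])
  · exact counts_of_charPoly (r := 4680) charPoly_midArrangement_seven
      (by norm_num [Nat.factorial])
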